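/- Let $K$ be a field of characteristic $0$ (for instance $\mathbb{C}$ or $\mathbb{R}$), and let $X \subset \mathbb{P}^N = \mathbb{P}^N(K)$ be an irreducible Zariski closed set of dimension $n$. Let $X_{sm}$ be its locus of smooth points and let $T_xX \subset \mathbb{P}^N$ be the embedded tangent $n$-plane at $x \in X_{sm}$. Let $r$ be the rank of the Gauss map $\gamma\colon X_{sm} \to \mathbb{G}(n,N)$, $x \mapsto T_xX$ (that is, the maximal rank of its differential), and let $l = n - r$ be the Gauss defect. The Gauss map is called degenerate if $r < n$; the case $r = n$ is also allowed here. The dual variety $X^* \subset (\mathbb{P}^N)^*$ is the closure of the set of hyperplanes $\xi$ with $\xi \supseteq T_xX$ for some $x \in X_{sm}$ (with $\dim \emptyset = -1$), and $X$ is called dually degenerate if $\dim X^* < N - l - 1$. At a smooth point $x$, an adapted frame consists of a representative $A_0$ of $x$, of vectors $A_1,\dots,A_l$ in the kernel of the differential of $\gamma$ at $x$, and of vectors $A_{l+1},\dots,A_n$ such that $A_0,\dots,A_n$ is a basis of the linear space over $T_xX$. For a linear form $\xi$ that vanishes on $T_xX$, let $$\Phi(\xi) = \xi_\alpha b^\alpha_{pq}\,\omega^p\omega^q,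 \qquad p,q = l+1,\dots,n,$$ be the corresponding quadratic form of the second fundamental form of $X$ at $x$, restricted to the $r$ directions $A_{l+1},\dots,A_n$: its coefficient $\xi_\alpha b^\alpha_{pq}$ is the value of $\xi$ on the first-order displacement (well defined modulo $T_xX$) of the tangent vector $A_p$ when $x$ moves on $X$ in the direction $A_q$. The form is singular if its $r\times r$ determinant vanishes. Then $X$ is dually degenerate if and only if at every smooth point $x \in X$, in every adapted frame, every quadratic form $\Phi(\xi) = \xi_\alpha b^\alpha_{pq}\,\omega^p\omega^q$ belonging to the second fundamental form of $X$ is singular. -/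

import Mathlib

open scoped LinearAlgebra.Projectivization

namespace DualVariety

noncomputable section

variable {K : Type*} [Field K] {N : ℕ}

/-! ### Projective algebraic sets -/

/-- Points of the projective space of dimension `N` over `K`. A point of the dual projective space
is given by its tangential coordinates, so it is a point `ξ` of the same type; it stands for the
hyperplane of all `x` with `∑ i, ξ i * x i = 0`. -/
abbrev Pr (K : Type*) [Field K] (N : ℕ) : Type _ := ℙ K (Fin (N + 1) → K)

/-- The affine cone over a set of projective points (it always contains the origin). -/
def affineCone (S : Set (Pr K N)) : Set (Fin (N + 1) → K) :=
  {v | ∀ hv : v ≠ 0, Projectivization.mk K v hv ∈ S}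

/-- The ideal of all polynomials that vanish on the affine cone over `S`. -/
def coneIdeal (S : Set (Pr K N)) : Ideal (MvPolynomial (Fin (N + 1)) K) :=
  MvPolynomial.vanishingIdeal K (affineCone S)

/-- The Zariski closure of a set of projective points. -/
def zariskiClosure (S : Set (Pr K N)) : Set (Pr K N) :=
  {p | ∀ f ∈ coneIdeal S, MvPolynomial.eval p.rep f = 0}

/-- Zariski closed sets of projective points. -/
def IsZariskiClosed (S : Set (Pr K N)) : Prop :=
  zariskiClosure S = S

/-- Irreducible projective varieties: nonempty Zariski closed sets that are not covered by two
Zariski closed sets unless one of the two contains them. -/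
structure IsVariety (X : Set (Pr K N)) : Prop where
  closed : IsZariskiClosed X
  nonempty : X.Nonempty
  irreducible : ∀ A B : Set (Pr K N), IsZariskiClosed A → IsZariskiClosed B →
    X ⊆ A ∪ B → X ⊆ A ∨ X ⊆ B

/-- The dimension of a projective algebraic set: the transcendence degree of its homogeneous
coordinate ring, minus one. The empty set has dimension `-1`. -/
def projDim (S : Set (Pr K N)) : ℤ :=
  (Cardinal.toNat
    (Algebra.trdeg K (MvPolynomial (Fin (N + 1)) K ⧸ coneIdeal S)) : ℤ) - 1

/-! ### Tangent spaces, the dual variety -/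

/-- The linear subspace of `K ^ (N + 1)` whose projectivization is the embedded tangent subspace
`T_x X` of `X` at `x`. -/
def tangentSpace (X : Set (Pr K N)) (x : Pr K N) : Submodule K (Fin (N + 1) → K) where
  carrier := {v | ∀ f ∈ coneIdeal X,
    ∑ i, MvPolynomial.eval x.rep (MvPolynomial.pderiv i f) * v i = 0}
  zero_mem' := by
    intro f _
    simp
  add_mem' := by
    intro a b ha hb f hf
    simp only [Pi.add_apply, mul_add, Finset.sum_add_distrib, ha f hf, hb f hf, add_zero]
  smul_mem' := by
    intro c a ha f hf
    have h : ∀ i, MvPolynomial.eval x.rep (MvPolynomial.pderiv i f) * (c • a) i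
        = c * (MvPolynomial.eval x.rep (MvPolynomial.pderiv i f) * a i) := by
      intro i
      simp only [Pi.smul_apply, smul_eq_mul]
      ring
    simp only [h, ← Finset.mul_sum, ha f hf, mul_zero]

/-- The locus of smooth points: the projective tangent subspace has the dimension of `X`. -/
def smoothLocus (X : Set (Pr K N)) : Set (Pr K N) :=
  {x | x ∈ X ∧ (Module.finrank K (tangentSpace X x) : ℤ) - 1 = projDim X}

/-- The hyperplanes that are tangent to `X` at some smooth point. -/
def tangentHyperplanes (X : Set (Pr K N)) : Set (Pr K N) :=
  {ξ | ∃ x ∈ smoothLocus X, ∀ v ∈ tangentSpace X x, ∑ i, ξ.rep i * v i = 0}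

/-- The dual variety: the closure of the set of hyperplanes tangent at smooth points. -/
def dualVariety (X : Set (Pr K N)) : Set (Pr K N) :=
  zariskiClosure (tangentHyperplanes X)

/-! ### The Gauss map and the second fundamental form -/

/-- First-order displacement of the tangent subspace. While the point `x` moves along `X` with
velocity `v`, the vector `w` of the tangent space at `x` can move with velocity `u` so as to stay
in the tangent space at the moving point, to first order: this is the derivative of the equations
`∑ j, (∂ f / ∂ x_j) (x) * w j = 0`, for `f` in the ideal of `X`, along `x' = v`, `w' = u`.
Thus at a smooth point the differential of the Gauss map `x ↦ T_x X` sends `v` to the linear map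
that sends `w` to the class of `u` modulo the tangent space. -/
def Displacement (X : Set (Pr K N)) (x : Pr K N) (v w u : Fin (N + 1) → K) : Prop :=
  ∀ f ∈ coneIdeal X,
    ∑ i, ∑ j, MvPolynomial.eval x.rep (MvPolynomial.pderiv i (MvPolynomial.pderiv j f)) * v i * w j
      + ∑ i, MvPolynomial.eval x.rep (MvPolynomial.pderiv i f) * u i = 0

/-- The kernel of the differential of the Gauss map at `x` (lifted to the affine cone, so that it
contains the line `x` itself): the tangent directions in which the tangent subspace is stationary
to first order. -/
def gaussKernel (X : Set (Pr K N)) (x : Pr K N) : Submodule K (Fin (N + 1) → K) where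
  carrier := {v | v ∈ tangentSpace X x ∧ ∀ w ∈ tangentSpace X x, Displacement X x v w 0}
  zero_mem' := by
    refine ⟨Submodule.zero_mem _, ?_⟩
    intro w _ f _
    simp
  add_mem' := by
    intro a b ha hb
    refine ⟨Submodule.add_mem _ ha.1 hb.1, ?_⟩
    intro w hw f hf
    have h1 := ha.2 w hw f hf
    have h2 := hb.2 w hw f hf
    simp only [Pi.zero_apply, mul_zero, Finset.sum_const_zero, add_zero] at h1 h2 ⊢
    simp only [Pi.add_apply, mul_add, add_mul, Finset.sum_add_distrib, h1, h2, add_zero]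
  smul_mem' := by
    intro c a ha
    refine ⟨Submodule.smul_mem _ c ha.1, ?_⟩
    intro w hw f hf
    have h1 := ha.2 w hw f hf
    simp only [Pi.zero_apply, mul_zero, Finset.sum_const_zero, add_zero] at h1 ⊢
    have h : ∀ i j,
        MvPolynomial.eval x.rep (MvPolynomial.pderiv i (MvPolynomial.pderiv j f)) * (c • a) i * w j
        = c * (MvPolynomial.eval x.rep (MvPolynomial.pderiv i (MvPolynomial.pderiv j f))
            * a i * w j) := by
      intro i j
      simp only [Pi.smul_apply, smul_eq_mul]
      ring
    simp only [h, ← Finset.mul_sum, h1, mul_zero]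

/-- The rank of the differential of the Gauss map at `x`. -/
def gaussRankAt (X : Set (Pr K N)) (x : Pr K N) : ℕ :=
  Module.finrank K (tangentSpace X x) - Module.finrank K (gaussKernel X x)

/-- The rank of the Gauss map: the largest (that is, the generic) rank of its differential at the
smooth points. -/
def gaussRank (X : Set (Pr K N)) : ℕ :=
  sSup (gaussRankAt X '' smoothLocus X)

/-- The second fundamental form of `X` at `x`, as a linear system of bilinear forms. Its members
are the forms `Φ(ξ)`, with `ξ` a linear form that vanishes on the tangent space: `Φ(ξ) (v, w)` is
the value of `ξ` on the displacement of the tangent vector `w` when `x` moves in direction `v`. -/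
def secondFundamentalForm (X : Set (Pr K N)) (x : Pr K N) :
    Set (LinearMap.BilinForm K (tangentSpace X x)) :=
  {Φ | ∃ ξ : Fin (N + 1) → K, (∀ v ∈ tangentSpace X x, ∑ i, ξ i * v i = 0) ∧
    ∀ (v w : tangentSpace X x) (u : Fin (N + 1) → K),
      Displacement X x v w u → Φ v w = ∑ i, ξ i * u i}

/-- Adapted frames `A_0, A_a, A_p` (`a = 1, …, l` and `p = l + 1, …, l + r`) of the tangent space
at `x`: `A_0` is the point `x`, and the `A_a` are directions of the leaf of the Gauss map. The `r`
vectors `A_p` then span a complement of the leaf; they represent the directions of the image of the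
Gauss map. -/
structure IsAdaptedFrame (X : Set (Pr K N)) (x : Pr K N) {l r : ℕ}
    (A : Module.Basis (Fin 1 ⊕ Fin l ⊕ Fin r) K (tangentSpace X x)) : Prop where
  point : (A (Sum.inl 0) : Fin (N + 1) → K) = x.rep
  leaf : ∀ a : Fin l, (A (Sum.inr (Sum.inl a)) : Fin (N + 1) → K) ∈ gaussKernel X x

/-- The `r × r` matrix `b_{pq}`, in an adapted frame, of a form on the tangent space. -/
def gaussMatrix {X : Set (Pr K N)} {x : Pr K N} {l r : ℕ}
    (A : Module.Basis (Fin 1 ⊕ Fin l ⊕ Fin r) K (tangentSpace X x))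
    (Φ : LinearMap.BilinForm K (tangentSpace X x)) : Matrix (Fin r) (Fin r) K :=
  Matrix.of fun p q => Φ (A (Sum.inr (Sum.inr p))) (A (Sum.inr (Sum.inr q)))

end

end DualVariety

/-! ### Derivations of fields of characteristic zero -/

namespace DualVariety

open MvPolynomial

/-! Let `y` be a generic point of the affine cone over X, with c = N - n equations `f` of X whose
Jacobian J has rank c at `y`, so that the tangent space is ker J. For independent indeterminates
`s`, the covector Jᵀ s is a generic point of the cone over X* (`aeval_conormal_eq_zero_iff`).

In characteristic 0 the transcendence degree of a generic point is the dimension of its space of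
tangent vectors, and these are the values of derivations (`toNat_trdeg_quotient`). A derivation D
sends Jᵀ s to Jᵀ D(s) + H D(y), where H is the Hessian of ∑ sₐ fₐ; here D(s) is arbitrary and D(y)
runs over ker J. Hence dim X* + 1 = dim (im Jᵀ + H(ker J)), which is the rank of the bordered matrix
B = (H Jᵀ; J 0) minus c (`projDim_dualVariety_add`). The kernel of B is a copy of the radical of H
restricted to ker J, so this generic radical has dimension N - dim X*. Thus dim X* ≥ N - l - 1 means
that the radical has dimension at most l + 1.

At a smooth K-point the forms of the second fundamental form are the restrictions of -H to the
tangent space. If one has a nonzero r × r determinant, its radical has dimension at most l + 1; the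
rank of B can only grow on passing to the generic point, so dim X* ≥ N - l - 1
(`le_projDim_dualVariety`). Conversely, a large generic rank of B is attained at some smooth K-point
(`exists_rank_bordered_of_le_projDim`). There the radical has dimension at most l + 1, while it
contains the Gauss kernel, of dimension at least l + 1 because the Gauss rank is at most r. The two
coincide, and the form is nonsingular on a complement (`exists_adaptedFrame_det_ne_zero`). -/

theorem formallySmooth_of_charZero (S L : Type*) [CommRing S] [IsDomain S] [Field L] [CharZero L]
    [Algebra S L] [FaithfulSMul S L] : Algebra.FormallySmooth S L := by
  let _ : Algebra (FractionRing S) L := FractionRing.liftAlgebra S L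
  have : IsScalarTower S (FractionRing S) L := FractionRing.isScalarTower_liftAlgebra S L
  have : Algebra.FormallySmooth S (FractionRing S) :=
    Algebra.FormallySmooth.of_isLocalization (nonZeroDivisors S)
  have : CharZero (FractionRing S) := (algebraMap (FractionRing S) L).charZero
  obtain ⟨s, hs⟩ := exists_isTranscendenceBasis (FractionRing S) L
  -- Over the field of fractions, L is algebraic over a purely transcendental extension, and
  -- separable in characteristic 0.
  have := hs.isAlgebraic_field
  have : Algebra.FormallySmooth (FractionRing S) L :=
    Algebra.FormallySmooth.of_algebraicIndependent_of_isSeparable hs.1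
  exact Algebra.FormallySmooth.comp S (FractionRing S) L

/-- The projection L[ε] → L has square-zero kernel, so formal smoothness lifts the identity of L.
The ε-component of such a lift will be a derivation. -/
theorem exists_lift_dualNumber {S L : Type*} [CommRing S] [CommRing L] [Algebra S L]
    [Algebra.FormallySmooth S L] (φ : S →+* TrivSqZeroExt L L)
    (hφ : ∀ a, (φ a).fst = algebraMap S L a) :
    ∃ ψ : L →+* TrivSqZeroExt L L, (∀ z, (ψ z).fst = z) ∧ ∀ a, ψ (algebraMap S L a) = φ a := by
  let _ : Algebra S (TrivSqZeroExt L L) := φ.toAlgebra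
  let g : TrivSqZeroExt L L →ₐ[S] L :=
    { (TrivSqZeroExt.fstHom L L L).toRingHom with
      commutes' := fun a => hφ a }
  have hg : Function.Surjective g := fun z => ⟨TrivSqZeroExt.inl z, rfl⟩
  have hg' : IsNilpotent (RingHom.ker (g : TrivSqZeroExt L L →+* L)) := by
    refine ⟨2, ?_⟩
    rw [Ideal.zero_eq_bot, eq_bot_iff]
    refine (sq (RingHom.ker (g : TrivSqZeroExt L L →+* L))).le.trans (Ideal.mul_le.2 ?_)
    intro a ha b hb
    have ha : a.fst = 0 := ha
    have hb : b.fst = 0 := hb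
    rw [Ideal.mem_bot]
    ext <;> simp [ha, hb]
  refine ⟨(Algebra.FormallySmooth.liftOfSurjective (AlgHom.id S L) g hg hg').toRingHom,
    fun z => ?_, fun a => ?_⟩
  · exact Algebra.FormallySmooth.liftOfSurjective_apply (AlgHom.id S L) g hg hg' z
  · exact (Algebra.FormallySmooth.liftOfSurjective (AlgHom.id S L) g hg hg').commutes a

/-! ### First-order Taylor expansion and the chain rule. -/

section

variable {K L σ : Type*} [Field K] [CommRing L] [Algebra K L] [Fintype σ]

theorem sum_aeval_pderiv_mul_X (y v : σ → L) (p : MvPolynomial σ K) (i : σ) :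
    ∑ j, aeval y (pderiv j (p * X i)) * v j
      = aeval y p * v i + y i * ∑ j, aeval y (pderiv j p) * v j := by
  classical
  have : ∀ j, aeval y (pderiv j (p * X i)) * v j
      = (if j = i then aeval y p * v i else 0) + y i * (aeval y (pderiv j p) * v j) := by
    intro j
    rw [pderiv_mul, pderiv_X]
    by_cases hj : j = i
    · subst hj
      simp
      ring
    · simp [hj, Ne.symm hj]
      ring
  rw [Finset.sum_congr rfl fun j _ => this j]
  simp [Finset.sum_add_distrib, Finset.mul_sum]

theorem aeval_inl_add_inr (y v : σ → L) (f : MvPolynomial σ K) :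
    aeval (fun i => (TrivSqZeroExt.inl (y i) + TrivSqZeroExt.inr (v i) : TrivSqZeroExt L L)) f =
      TrivSqZeroExt.inl (aeval y f) + TrivSqZeroExt.inr (∑ i, aeval y (pderiv i f) * v i) := by
  induction f using MvPolynomial.induction_on with
  | C a => simp [← MvPolynomial.algebraMap_eq, TrivSqZeroExt.algebraMap_eq_inl']
  | add p q hp hq =>
    simp only [map_add, hp, hq, add_mul, Finset.sum_add_distrib, TrivSqZeroExt.inl_add,
      TrivSqZeroExt.inr_add]
    abel
  | mul_X p i hp =>
    rw [map_mul, hp, aeval_X, map_mul, aeval_X, sum_aeval_pderiv_mul_X]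
    ext
    · simp
    · simp
      ring

theorem derivation_aeval (D : Derivation K L L) (y : σ → L) (f : MvPolynomial σ K) :
    D (aeval y f) = ∑ i, aeval y (pderiv i f) * D (y i) := by
  induction f using MvPolynomial.induction_on with
  | C a => simp [← MvPolynomial.algebraMap_eq]
  | add p q hp hq => simp only [map_add, hp, hq, add_mul, Finset.sum_add_distrib]
  | mul_X p i hp =>
    rw [map_mul, Derivation.leibniz, aeval_X, hp, sum_aeval_pderiv_mul_X]
    rfl

end

variable {K L σ : Type*} [Field K] [Field L] [Algebra K L] [Fintype σ]

/-- A tangent vector, with coordinates in `L`, at a point `y` of an affine variety over `K` with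
coordinates in `L`, comes from a derivation of `L`. -/
theorem exists_derivation [CharZero L] (y v : σ → L)
    (h : ∀ f : MvPolynomial σ K, aeval y f = 0 → ∑ i, aeval y (pderiv i f) * v i = 0) :
    ∃ D : Derivation K L L, ∀ i, D (y i) = v i := by
  let S := (aeval y : MvPolynomial σ K →ₐ[K] L).range
  have : Algebra.FormallySmooth S L := formallySmooth_of_charZero S L
  let Y : σ → TrivSqZeroExt L L := fun i => TrivSqZeroExt.inl (y i) + TrivSqZeroExt.inr (v i)
  let π : MvPolynomial σ K →+* S := ((aeval y : MvPolynomial σ K →ₐ[K] L).rangeRestrict : _ →+* S)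
  have hπ : Function.Surjective π := (aeval y : MvPolynomial σ K →ₐ[K] L).rangeRestrict_surjective
  let θ : MvPolynomial σ K →+* TrivSqZeroExt L L := (aeval Y : _ →ₐ[K] TrivSqZeroExt L L)
  -- The hypothesis on `v` says that every relation of y also holds for y + εv, so evaluation at y +
  -- εv descends to K[y].
  have hker : RingHom.ker π ≤ RingHom.ker θ := by
    intro f hf
    have hf : aeval y f = 0 := congrArg Subtype.val ((RingHom.mem_ker).1 hf)
    rw [RingHom.mem_ker]
    change aeval Y f = 0
    rw [aeval_inl_add_inr, hf, h f hf]
    simp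
  let φ : S →+* TrivSqZeroExt L L := π.liftOfSurjective hπ ⟨θ, hker⟩
  have hφ : ∀ f, φ (π f) = θ f := fun f => RingHom.liftOfRightInverse_comp_apply _ _ _ ⟨θ, hker⟩ f
  have hθ : ∀ f, (θ f).fst = aeval y f := by
    intro f
    change (aeval Y f).fst = _
    rw [aeval_inl_add_inr]
    simp
  obtain ⟨ψ, hψ, hψφ⟩ := exists_lift_dualNumber φ (by
    intro a
    obtain ⟨f, rfl⟩ := hπ a
    rw [hφ, hθ]
    rfl)
  have hψ' : ∀ f : MvPolynomial σ K, (ψ (aeval y f)).snd = ∑ i, aeval y (pderiv i f) * v i := by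
    intro f
    have h1 : ψ (aeval y f) = θ f := (hψφ (π f)).trans (hφ f)
    rw [h1]
    change (aeval Y f).snd = _
    rw [aeval_inl_add_inr]
    simp
  have hK : ∀ c : K, (ψ (algebraMap K L c)).snd = 0 := by
    intro c
    have := hψ' (C c)
    simpa using this
  refine ⟨Derivation.mk' ⟨⟨fun z => (ψ z).snd, fun a b => by simp⟩, fun c z => ?_⟩ ?_, fun i => ?_⟩
  · simp only [Algebra.smul_def, map_mul, TrivSqZeroExt.snd_mul, hψ, hK, RingHom.id_apply]
    simp
  · intro a b
    simp [TrivSqZeroExt.snd_mul, hψ, mul_comm]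
  · classical
    have := hψ' (X i)
    simpa [pderiv_X, Pi.single_apply] using this

/-- The constants of D form a subfield over which `z` is algebraic. Its minimal polynomial m is
separable, and m'(z) D z = 0. -/
theorem derivation_eq_zero_of_root [CharZero L] (D : Derivation K L L) (p : Polynomial L)
    (hp : p ≠ 0) (hD : ∀ n, D (p.coeff n) = 0) (z : L) (hz : p.eval z = 0) : D z = 0 := by
  let C : Subfield L :=
    { carrier := {a | D a = 0}
      mul_mem' := by
        intro a b ha hb
        simp only [Set.mem_ofPred_eq] at ha hb ⊢
        simp [ha, hb]
      one_mem' := by simp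
      add_mem' := by
        intro a b ha hb
        simp only [Set.mem_ofPred_eq] at ha hb ⊢
        simp [ha, hb]
      zero_mem' := by simp
      neg_mem' := by
        intro a ha
        simp only [Set.mem_ofPred_eq] at ha ⊢
        simp [ha]
      inv_mem' := by
        intro a ha
        simp only [Set.mem_ofPred_eq] at ha ⊢
        simp [Derivation.leibniz_inv, ha] }
  let D' : Derivation C L L := Derivation.mk' ⟨⟨D, map_add D⟩, by
    intro c w
    have hc : D (c : L) = 0 := c.2
    simp [Subfield.smul_def, hc]⟩ (fun a b => D.leibniz a b)
  have hlift : p ∈ Polynomial.lifts (algebraMap C L) := by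
    rw [Polynomial.lifts_iff_coeff_lifts]
    exact fun n => ⟨⟨p.coeff n, hD n⟩, rfl⟩
  obtain ⟨q, rfl⟩ := (Polynomial.mem_lifts _).1 hlift
  have hzC : IsAlgebraic C z := by
    refine ⟨q, fun h => hp (by simp [h]), ?_⟩
    rwa [Polynomial.eval_map_algebraMap] at hz
  have hint := hzC.isIntegral
  have hsep := (minpoly.irreducible hint).separable
  have h1 : D' (Polynomial.aeval z (minpoly C z)) = _ := D'.map_aeval (minpoly C z) z
  rw [minpoly.aeval, map_zero, smul_eq_mul, eq_comm, mul_eq_zero] at h1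
  exact h1.resolve_left (hsep.aeval_derivative_ne_zero (minpoly.aeval C z))

/-- The tangent space, with coordinates in `A`, of the affine variety of `I` at a point `y`. -/
def tangentAt {A : Type*} [Field A] [Algebra K A] (I : Ideal (MvPolynomial σ K)) (y : σ → A) :
    Submodule A (σ → A) where
  carrier := {v | ∀ f ∈ I, ∑ i, aeval y (pderiv i f) * v i = 0}
  zero_mem' := by
    intro f _
    simp
  add_mem' := by
    intro a b ha hb f hf
    simp only [Pi.add_apply, mul_add, Finset.sum_add_distrib, ha f hf, hb f hf, add_zero]
  smul_mem' := by
    intro c a ha f hf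
    simp only [Pi.smul_apply, smul_eq_mul, mul_left_comm _ c, ← Finset.mul_sum, ha f hf, mul_zero]

theorem mem_tangentAt {A : Type*} [Field A] [Algebra K A] {I : Ideal (MvPolynomial σ K)}
    {y v : σ → A} : v ∈ tangentAt I y ↔ ∀ f ∈ I, ∑ i, aeval y (pderiv i f) * v i = 0 :=
  Iff.rfl

theorem mem_tangentAt_iff_exists_derivation [CharZero L] {I : Ideal (MvPolynomial σ K)}
    {y : σ → L} (hI : ∀ f, aeval y f = 0 ↔ f ∈ I) {v : σ → L} :
    v ∈ tangentAt I y ↔ ∃ D : Derivation K L L, ∀ i, D (y i) = v i := by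
  constructor
  · intro h
    exact exists_derivation y v fun f hf => h f ((hI f).1 hf)
  · rintro ⟨D, hD⟩ f hf
    have := derivation_aeval D y f
    rw [(hI f).2 hf, map_zero] at this
    simp only [← hD, ← this]

/-- In characteristic zero, the transcendence degree of a finitely generated domain is the
dimension of the space of tangent vectors at its generic point. -/
theorem toNat_trdeg_eq_finrank_tangentAt [CharZero L] {I : Ideal (MvPolynomial σ K)} {y : σ → L}
    (hI : ∀ f, aeval y f = 0 ↔ f ∈ I) {S : Type*} [CommRing S] [IsDomain S] [Algebra K S]
    (ι : S →ₐ[K] L) (hι : Function.Injective ι) (x : σ → S) (hιx : ∀ i, ι (x i) = y i)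
    (htop : Algebra.adjoin K (Set.range x) = ⊤) :
    Cardinal.toNat (Algebra.trdeg K S) = Module.finrank L (tangentAt I y) := by
  classical
  have halg : Algebra.IsAlgebraic (Algebra.adjoin K (Set.range x)) S := by
    rw [htop]
    exact ⟨fun z => isAlgebraic_algebraMap (⟨z, Algebra.mem_top⟩ : (⊤ : Subalgebra K S))⟩
  obtain ⟨t, hts, ht⟩ := exists_isTranscendenceBasis_subset (R := K) (Set.range x)
  have htfin : Finite t := (Set.finite_range x).subset hts
  have := Fintype.ofFinite t
  choose κ hκ using fun b : t => hts b.2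
  have hyκ : ∀ b : t, y (κ b) = ι b := fun b => by rw [← hιx, hκ]
  have hind : AlgebraicIndependent K fun b : t => y (κ b) := by
    have := ht.1.map' hι
    convert this using 1
    ext b
    exact hyκ b
  -- Reading a tangent vector on a transcendence basis is an isomorphism. A derivation that kills
  -- the basis kills everything algebraic over it; conversely, independent coordinates satisfy no
  -- relation, so their derivatives can be prescribed.
  let ρ : tangentAt I y →ₗ[L] (t → L) :=
    (LinearMap.funLeft L L κ).comp (tangentAt I y).subtype
  have hinj : Function.Injective ρ := by
    rw [injective_iff_map_eq_zero]
    rintro ⟨v, hv⟩ hv0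
    obtain ⟨D, hD⟩ := (mem_tangentAt_iff_exists_derivation hI).1 hv
    have hDt : ∀ b : t, D (ι b) = 0 := by
      intro b
      rw [← hyκ, hD]
      exact congrFun hv0 b
    have hDadj : ∀ a ∈ Algebra.adjoin K (Set.range ((↑) : t → S)), D (ι a) = 0 := by
      intro a ha
      induction ha using Algebra.adjoin_induction with
      | mem a ha =>
        obtain ⟨b, rfl⟩ := ha
        exact hDt b
      | algebraMap r => simp
      | add a b _ _ ha hb => simp [ha, hb]
      | mul a b _ _ ha hb => simp [ha, hb]
    ext i
    obtain ⟨p, hp, hpz⟩ := ht.isAlgebraic.isAlgebraic (x i)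
    have hinj' : Function.Injective
        ((ι : S →+* L).comp (algebraMap (Algebra.adjoin K (Set.range ((↑) : t → S))) S)) :=
      hι.comp Subtype.val_injective
    have := derivation_eq_zero_of_root D (p.map ((ι : S →+* L).comp (algebraMap _ S)))
      ((Polynomial.map_ne_zero_iff hinj').2 hp)
      (fun n => by
        rw [Polynomial.coeff_map]
        exact hDadj _ (p.coeff n).2) (ι (x i)) (by
        rw [Polynomial.eval_map]
        refine (Polynomial.hom_eval₂ p (algebraMap _ S) (ι : S →+* L) (x i)).symm.trans ?_
        rw [← Polynomial.aeval_def, hpz, map_zero])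
    rw [hιx, hD] at this
    exact this
  have hsurj : Function.Surjective ρ := by
    intro a
    obtain ⟨D, hD⟩ := exists_derivation (K := K) (fun b : t => y (κ b)) a (by
      intro f hf
      have : f = 0 := (injective_iff_map_eq_zero _).1 hind f hf
      simp [this])
    exact ⟨⟨fun i => D (y i), (mem_tangentAt_iff_exists_derivation hI).2 ⟨D, fun _ => rfl⟩⟩,
      funext hD⟩
  have h1 := (LinearEquiv.ofBijective ρ ⟨hinj, hsurj⟩).finrank_eq
  rw [h1, Module.finrank_fintype_fun_eq_card, ← ht.cardinalMk_eq_trdeg]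
  simp

theorem toNat_trdeg_quotient [CharZero L] {I : Ideal (MvPolynomial σ K)}
    {y : σ → L} (hI : ∀ f, aeval y f = 0 ↔ f ∈ I) :
    Cardinal.toNat (Algebra.trdeg K (MvPolynomial σ K ⧸ I)) =
      Module.finrank L (tangentAt I y) := by
  have hker : I = RingHom.ker (aeval y : MvPolynomial σ K →ₐ[K] L) := by
    ext f
    rw [RingHom.mem_ker, hI]
  have : I.IsPrime := by
    rw [hker]
    exact RingHom.ker_isPrime _
  let ι : (MvPolynomial σ K ⧸ I) →ₐ[K] L := Ideal.Quotient.liftₐ I (aeval y) fun f hf => (hI f).2 hf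
  have hι : ∀ f, ι (Ideal.Quotient.mk I f) = aeval y f := fun f => rfl
  refine toNat_trdeg_eq_finrank_tangentAt hI ι ?_ (fun i => Ideal.Quotient.mk I (X i))
    (fun i => by rw [hι, aeval_X]) ?_
  · rw [injective_iff_map_eq_zero]
    intro z hz
    obtain ⟨f, rfl⟩ := Ideal.Quotient.mk_surjective z
    rw [hι, hI] at hz
    exact Ideal.Quotient.eq_zero_iff_mem.2 hz
  · have h1 : (aeval fun i => Ideal.Quotient.mk I (X i) : MvPolynomial σ K →ₐ[K] _) =
        Ideal.Quotient.mkₐ K I := by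
      ext i
      simp
    rw [Algebra.adjoin_range_eq_range_aeval, h1, AlgHom.range_eq_top]
    exact Ideal.Quotient.mkₐ_surjective K I

end DualVariety

/-! ### Ranks of bordered matrices -/

namespace DualVariety

open Matrix

section LinearAlgebra

variable {A : Type*} [Field A] {m n : Type*} [Fintype m] [Fintype n]

theorem exists_rows_linearIndependent (M : Matrix m n A) {k : ℕ} (hk : k ≤ M.rank) :
    ∃ r : Fin k → m, LinearIndependent A (M.submatrix r id).row := by
  rw [rank_eq_finrank_span_row] at hk
  obtain ⟨f, hf, -, hind⟩ := Submodule.exists_fun_fin_finrank_span_eq A (Set.range M.row)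
  choose r hr using hf
  refine ⟨fun i => r (Fin.castLE hk i), ?_⟩
  have h : (M.submatrix (fun i => r (Fin.castLE hk i)) id).row = f ∘ Fin.castLE hk :=
    funext fun i => hr (Fin.castLE hk i)
  rw [h]
  exact hind.comp _ (Fin.castLE_injective hk)

theorem le_rank_iff_exists_submatrix_det_ne_zero (M : Matrix m n A) (k : ℕ) :
    k ≤ M.rank ↔ ∃ (r : Fin k → m) (s : Fin k → n), (M.submatrix r s).det ≠ 0 := by
  constructor
  · intro hk
    obtain ⟨r, hr⟩ := exists_rows_linearIndependent M hk
    have h1 : (M.submatrix r id).rank = k := by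
      rw [hr.rank_matrix, Fintype.card_fin]
    obtain ⟨s, hs⟩ := exists_rows_linearIndependent (M.submatrix r id)ᵀ (k := k)
      (by rw [rank_transpose, h1])
    refine ⟨r, s, ?_⟩
    have h2 : ((M.submatrix r s)ᵀ).det ≠ 0 := by
      rw [← isUnit_iff_ne_zero, ← Matrix.isUnit_iff_isUnit_det,
        ← Matrix.linearIndependent_rows_iff_isUnit]
      exact hs
    rwa [det_transpose] at h2
  · rintro ⟨r, s, h⟩
    have h1 := rank_of_det_ne_zero h
    rw [Fintype.card_fin] at h1
    exact h1.symm.le.trans (rank_submatrix_le M r s)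

/-- Rank at least k is an open condition: one nonvanishing minor δ witnesses it wherever δ survives.
This carries generic ranks to K-points. -/
theorem exists_le_rank_map_of_ne_zero {R B : Type*} [CommRing R] [Field B] (M : Matrix m n R)
    (φ : R →+* A) {k : ℕ} (hk : k ≤ (M.map φ).rank) :
    ∃ δ : R, φ δ ≠ 0 ∧ ∀ ψ : R →+* B, ψ δ ≠ 0 → k ≤ (M.map ψ).rank := by
  obtain ⟨r, s, h⟩ := (le_rank_iff_exists_submatrix_det_ne_zero _ _).1 hk
  refine ⟨(M.submatrix r s).det, ?_, fun ψ hψ =>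
    (le_rank_iff_exists_submatrix_det_ne_zero _ _).2 ⟨r, s, ?_⟩⟩
  · rwa [RingHom.map_det]
  · rwa [RingHom.map_det] at hψ

theorem rank_map_le_of_ker_le {R B : Type*} [CommRing R] [Field B] (M : Matrix m n R)
    (φ : R →+* A) (ψ : R →+* B) (h : ∀ a, φ a = 0 → ψ a = 0) :
    (M.map ψ).rank ≤ (M.map φ).rank := by
  obtain ⟨δ, hδ, hφ⟩ := exists_le_rank_map_of_ne_zero (B := A) M ψ le_rfl
  exact hφ φ fun h0 => hδ (h δ h0)

theorem finrank_ker_mulVecLin {l : Type*} (M : Matrix l n A) :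
    M.rank + Module.finrank A (LinearMap.ker M.mulVecLin) = Fintype.card n := by
  have := LinearMap.finrank_range_add_finrank_ker M.mulVecLin
  rwa [Module.finrank_fintype_fun_eq_card] at this

theorem mulVecLin_surjective_of_rank (J : Matrix m n A) (hJ : J.rank = Fintype.card m) :
    Function.Surjective J.mulVecLin := by
  rw [← LinearMap.range_eq_top]
  apply Submodule.eq_top_of_finrank_eq
  rw [Module.finrank_fintype_fun_eq_card]
  exact hJ

theorem transpose_mulVecLin_injective_of_rank (J : Matrix m n A) (hJ : J.rank = Fintype.card m) :
    Function.Injective Jᵀ.mulVecLin := by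
  have h := finrank_ker_mulVecLin Jᵀ
  rw [rank_transpose, hJ, Nat.add_eq_left, Submodule.finrank_eq_zero] at h
  exact LinearMap.ker_eq_bot.1 h

/-- A vector orthogonal to the kernel of a matrix is a combination of the rows. -/
theorem exists_transpose_mulVec_eq (J : Matrix m n A) (u : n → A)
    (hu : ∀ w, J *ᵥ w = 0 → u ⬝ᵥ w = 0) : ∃ a, Jᵀ *ᵥ a = u := by
  classical
  by_contra hne
  have hu' : u ∉ LinearMap.range Jᵀ.mulVecLin := fun ⟨a, ha⟩ => hne ⟨a, ha⟩
  obtain ⟨φ, hφ, hφ0⟩ := Submodule.exists_le_ker_of_notMem hu'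
  have hφw : ∀ v, φ v = v ⬝ᵥ fun i => φ (Pi.single i 1) := by
    intro v
    conv_lhs => rw [← Finset.univ_sum_single v]
    rw [map_sum]
    refine Finset.sum_congr rfl fun i _ => ?_
    rw [← smul_eq_mul, ← map_smul, ← Pi.single_smul, smul_eq_mul, mul_one]
  apply hφ
  rw [hφw]
  apply hu
  ext a
  have h1 := hφ0 (LinearMap.mem_range_self Jᵀ.mulVecLin (Pi.single a 1))
  rw [LinearMap.mem_ker, hφw] at h1
  simpa [Matrix.mulVec, dotProduct] using h1

/-- The space of tangent vectors to the conormal directions `Jᵀ a`: the sum of the row space of `J`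
and of the image under `H` of the kernel of `J`. -/
def borderedImage (H : Matrix n n A) (J : Matrix m n A) : Submodule A (n → A) :=
  LinearMap.range Jᵀ.mulVecLin ⊔ (LinearMap.ker J.mulVecLin).map H.mulVecLin

/-- The radical of the restriction of the form `H` to the kernel of `J`. -/
def restrictedRadical (H : Matrix n n A) (J : Matrix m n A) : Submodule A (n → A) where
  carrier := {v | J *ᵥ v = 0 ∧ ∀ w, J *ᵥ w = 0 → (H *ᵥ v) ⬝ᵥ w = 0}
  zero_mem' := by simp
  add_mem' := by
    intro a b ha hb
    refine ⟨by rw [mulVec_add, ha.1, hb.1, add_zero], fun w hw => ?_⟩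
    rw [mulVec_add, add_dotProduct, ha.2 w hw, hb.2 w hw, add_zero]
  smul_mem' := by
    intro c a ha
    refine ⟨by rw [mulVec_smul, ha.1, smul_zero], fun w hw => ?_⟩
    rw [mulVec_smul, smul_dotProduct, ha.2 w hw, smul_zero]

/-- The matrix `H` bordered by the rows of `J`. -/
def bordered {A : Type*} [CommRing A] {m n : Type*} (H : Matrix n n A) (J : Matrix m n A) :
    Matrix (n ⊕ m) (n ⊕ m) A :=
  fromBlocks H Jᵀ J 0

theorem bordered_mulVec (H : Matrix n n A) (J : Matrix m n A) (v : n → A) (a : m → A) :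
    bordered H J *ᵥ Sum.elim v a = Sum.elim (H *ᵥ v + Jᵀ *ᵥ a) (J *ᵥ v) := by
  simp [bordered, fromBlocks_mulVec]

/-- Project the range of the bordered matrix to the `m`-component. The projection is onto because J
is, and its kernel is the set of Hv + Jᵀa with Jv = 0. -/
theorem finrank_borderedImage_add (H : Matrix n n A) (J : Matrix m n A)
    (hJ : J.rank = Fintype.card m) :
    Module.finrank A (borderedImage H J) + Fintype.card m = (bordered H J).rank := by
  let B := bordered H J
  let ρ : LinearMap.range B.mulVecLin →ₗ[A] (m → A) :=
    (LinearMap.funLeft A A Sum.inr).comp (LinearMap.range B.mulVecLin).subtype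
  have hsurj : LinearMap.range ρ = ⊤ := by
    rw [LinearMap.range_eq_top]
    intro b
    obtain ⟨v, hv⟩ := mulVecLin_surjective_of_rank J hJ b
    refine ⟨⟨B.mulVecLin (Sum.elim v 0), LinearMap.mem_range_self _ _⟩, ?_⟩
    ext i
    change (B *ᵥ Sum.elim v 0) (Sum.inr i) = b i
    rw [bordered_mulVec, Sum.elim_inr, ← hv]
    rfl
  have hker : Module.finrank A (LinearMap.ker ρ) = Module.finrank A (borderedImage H J) := by
    let τ : LinearMap.ker ρ →ₗ[A] (n → A) :=
      (LinearMap.funLeft A A Sum.inl).comp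
        ((LinearMap.range B.mulVecLin).subtype.comp (LinearMap.ker ρ).subtype)
    have hτ : Function.Injective τ := by
      rw [injective_iff_map_eq_zero]
      rintro ⟨⟨z, hz⟩, hz0⟩ h
      ext i
      rcases i with i | i
      · exact congrFun h i
      · exact congrFun hz0 i
    have hrange : LinearMap.range τ = borderedImage H J := by
      ext u
      constructor
      · rintro ⟨⟨⟨z, hz⟩, hz0⟩, rfl⟩
        obtain ⟨y, rfl⟩ := hz
        obtain ⟨v, a, rfl⟩ : ∃ v a, y = Sum.elim v a :=
          ⟨y ∘ Sum.inl, y ∘ Sum.inr, (Sum.elim_comp_inl_inr y).symm⟩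
        have h0 : J *ᵥ v = 0 := by
          have : (B *ᵥ Sum.elim v a) ∘ Sum.inr = 0 := hz0
          rwa [bordered_mulVec, Sum.elim_comp_inr] at this
        change (B *ᵥ Sum.elim v a) ∘ Sum.inl ∈ _
        rw [bordered_mulVec, Sum.elim_comp_inl, add_comm]
        exact Submodule.add_mem_sup (LinearMap.mem_range_self Jᵀ.mulVecLin a)
          (Submodule.mem_map_of_mem (f := H.mulVecLin) (LinearMap.mem_ker.2 h0))
      · intro hu
        obtain ⟨_, ⟨a, rfl⟩, _, ⟨v, hv, rfl⟩, rfl⟩ := Submodule.mem_sup.1 hu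
        refine ⟨⟨⟨B.mulVecLin (Sum.elim v a), LinearMap.mem_range_self _ _⟩, ?_⟩, ?_⟩
        · rw [LinearMap.mem_ker]
          change (B *ᵥ Sum.elim v a) ∘ Sum.inr = 0
          rw [bordered_mulVec, Sum.elim_comp_inr]
          exact hv
        · change (B *ᵥ Sum.elim v a) ∘ Sum.inl = _
          rw [bordered_mulVec, Sum.elim_comp_inl, add_comm]
          rfl
    rw [← hrange, LinearMap.finrank_range_of_inj hτ]
  have := LinearMap.finrank_range_add_finrank_ker ρ
  rw [hsurj, finrank_top, Module.finrank_fintype_fun_eq_card, hker, add_comm] at this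
  exact this

/-- (v, a) lies in the kernel of the bordered matrix when Jv = 0 and Hv = -Jᵀa; such an a exists
exactly if Hv is orthogonal to ker J, and it is unique because Jᵀ is injective. -/
theorem finrank_restrictedRadical_add (H : Matrix n n A) (J : Matrix m n A)
    (hJ : J.rank = Fintype.card m) :
    Module.finrank A (restrictedRadical H J) + (bordered H J).rank =
      Fintype.card n + Fintype.card m := by
  let B := bordered H J
  have h := finrank_ker_mulVecLin B
  rw [Fintype.card_sum] at h
  let τ : LinearMap.ker B.mulVecLin →ₗ[A] (n → A) :=
    (LinearMap.funLeft A A Sum.inl).comp (LinearMap.ker B.mulVecLin).subtype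
  have hmem : ∀ v a, Sum.elim v a ∈ LinearMap.ker B.mulVecLin ↔
      H *ᵥ v + Jᵀ *ᵥ a = 0 ∧ J *ᵥ v = 0 := by
    intro v a
    rw [LinearMap.mem_ker, mulVecLin_apply, bordered_mulVec]
    constructor
    · intro h
      exact ⟨by simpa using congrArg (· ∘ Sum.inl) h, by simpa using congrArg (· ∘ Sum.inr) h⟩
    · rintro ⟨h1, h2⟩
      rw [h1, h2]
      ext i
      cases i <;> rfl
  have hτ : Function.Injective τ := by
    rw [injective_iff_map_eq_zero]
    rintro ⟨y, hy⟩ h0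
    obtain ⟨v, a, rfl⟩ : ∃ v a, y = Sum.elim v a :=
      ⟨y ∘ Sum.inl, y ∘ Sum.inr, (Sum.elim_comp_inl_inr y).symm⟩
    have hv : v = 0 := h0
    subst hv
    have ha := ((hmem _ _).1 hy).1
    rw [mulVec_zero, zero_add] at ha
    have ha : a = 0 := transpose_mulVecLin_injective_of_rank J hJ
      (show Jᵀ *ᵥ a = Jᵀ *ᵥ 0 by rw [ha, mulVec_zero])
    subst ha
    ext i
    cases i <;> rfl
  have hrange : LinearMap.range τ = restrictedRadical H J := by
    ext v
    constructor
    · rintro ⟨⟨y, hy⟩, rfl⟩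
      obtain ⟨v, a, rfl⟩ : ∃ v a, y = Sum.elim v a :=
        ⟨y ∘ Sum.inl, y ∘ Sum.inr, (Sum.elim_comp_inl_inr y).symm⟩
      obtain ⟨h1, h2⟩ := (hmem _ _).1 hy
      refine ⟨h2, fun w hw => ?_⟩
      change (H *ᵥ v) ⬝ᵥ w = 0
      rw [eq_neg_of_add_eq_zero_left h1, neg_dotProduct, mulVec_transpose,
        ← dotProduct_mulVec, hw, dotProduct_zero, neg_zero]
    · rintro ⟨hv, hw⟩
      obtain ⟨a, ha⟩ := exists_transpose_mulVec_eq J _ hw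
      refine ⟨⟨Sum.elim v (-a), (hmem _ _).2 ⟨?_, hv⟩⟩, rfl⟩
      rw [mulVec_neg, ha, add_neg_cancel]
  rw [← hrange, LinearMap.finrank_range_of_inj hτ, ← h, add_comm]

end LinearAlgebra

/-! ### Jacobians, Hessians and their universal polynomial versions. -/

section Jacobian

open MvPolynomial

variable {K A σ : Type*} [Field K] [Field A] [Algebra K A]

/-- The Jacobian matrix of a family of polynomials at the point `y`. -/
noncomputable def jacobian {ι : Type*} (f : ι → MvPolynomial σ K) (y : σ → A) : Matrix ι σ A :=
  Matrix.of fun a i => aeval y (pderiv i (f a))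

/-- The combination with coefficients `s` of the Hessians of a family of polynomials at `y`. -/
noncomputable def hessian {ι : Type*} [Fintype ι] (f : ι → MvPolynomial σ K) (y : σ → A)
    (s : ι → A) : Matrix σ σ A :=
  Matrix.of fun i j => ∑ a, s a * aeval y (pderiv i (pderiv j (f a)))

/-- The universal Jacobian matrix of a family of polynomials. -/
noncomputable def jacobianPoly {ι : Type*} (f : ι → MvPolynomial σ K) :
    Matrix ι σ (MvPolynomial σ K) :=
  Matrix.of fun a i => pderiv i (f a)

theorem jacobianPoly_map {ι : Type*} (f : ι → MvPolynomial σ K) (y : σ → A) :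
    (jacobianPoly f).map (aeval y : MvPolynomial σ K →ₐ[K] A).toRingHom = jacobian f y :=
  rfl

/-- The universal bordered Hessian of a family of polynomials, with coefficients adjoined. -/
noncomputable def borderedPoly {ι : Type*} [Fintype ι] (f : ι → MvPolynomial σ K) :
    Matrix (σ ⊕ ι) (σ ⊕ ι) (MvPolynomial (σ ⊕ ι) K) :=
  bordered
    (Matrix.of fun i j => ∑ a, X (Sum.inr a) * rename Sum.inl (pderiv i (pderiv j (f a))))
    (Matrix.of fun a i => rename Sum.inl (pderiv i (f a)))

theorem aeval_elim_rename_inl {ι : Type*} (y : σ → A) (s : ι → A) (f : MvPolynomial σ K) :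
    aeval (Sum.elim y s) (rename Sum.inl f) = aeval y f := by
  rw [aeval_rename, Sum.elim_comp_inl]

/-- All bordered Hessians are specializations of one polynomial matrix, so ranks at different points
can be compared through its minors. -/
theorem borderedPoly_map {ι : Type*} [Fintype ι] (f : ι → MvPolynomial σ K) (y : σ → A)
    (s : ι → A) :
    (borderedPoly f).map (aeval (Sum.elim y s) : MvPolynomial (σ ⊕ ι) K →ₐ[K] A).toRingHom =
      bordered (hessian f y s) (jacobian f y) := by
  ext i j
  rcases i with i | i <;> rcases j with j | j <;>
    simp [borderedPoly, bordered, hessian, jacobian, aeval_elim_rename_inl]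

variable [Fintype σ]

theorem tangentAt_le_ker_jacobian {I : Ideal (MvPolynomial σ K)} {ι : Type*}
    {f : ι → MvPolynomial σ K} (hf : ∀ a, f a ∈ I) (y : σ → A) :
    tangentAt I y ≤ LinearMap.ker (jacobian f y).mulVecLin := by
  intro v hv
  rw [LinearMap.mem_ker]
  ext a
  exact hv (f a) (hf a)

theorem exists_jacobian_rank (I : Ideal (MvPolynomial σ K)) (y : σ → A) {c d : ℕ}
    (hd : Module.finrank A (tangentAt I y) = d) (hcd : c + d = Fintype.card σ) :
    ∃ f : Fin c → MvPolynomial σ K, (∀ a, f a ∈ I) ∧ (jacobian f y).rank = c := by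
  -- The tangent space is the orthogonal of the span of all gradients; equations whose gradients
  -- form a basis of that span suffice.
  let G : Set (σ → A) := {u | ∃ f ∈ I, u = fun i => aeval y (pderiv i f)}
  obtain ⟨u, hu, hspan, hind⟩ := Submodule.exists_fun_fin_finrank_span_eq A G
  choose f hfI hf using hu
  have hJ : jacobian f y = Matrix.of u := by
    ext a i
    exact congrFun (hf a).symm i
  have hrank : (jacobian f y).rank = Module.finrank A (Submodule.span A G) := by
    rw [hJ]
    exact (LinearIndependent.rank_matrix (M := Matrix.of u) hind).trans (Fintype.card_fin _)
  have hker : LinearMap.ker (jacobian f y).mulVecLin = tangentAt I y := by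
    refine le_antisymm (fun v hv g hg => ?_) (tangentAt_le_ker_jacobian hfI y)
    have hg' : (fun i => aeval y (pderiv i g)) ∈ Submodule.span A (Set.range u) := by
      rw [hspan]
      exact Submodule.subset_span ⟨g, hg, rfl⟩
    change (fun i => aeval y (pderiv i g)) ⬝ᵥ v = 0
    generalize (fun i => aeval y (pderiv i g)) = w at hg'
    induction hg' using Submodule.span_induction with
    | mem w hw =>
      obtain ⟨a, rfl⟩ := hw
      rw [hf]
      exact congrFun hv a
    | zero => simp
    | add w w' _ _ hw hw' => rw [add_dotProduct, hw, hw', add_zero]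
    | smul r w _ hw => rw [smul_dotProduct, hw, smul_zero]
  have h := finrank_ker_mulVecLin (jacobian f y)
  rw [hker, hd, hrank] at h
  have hc := Nat.add_right_cancel (h.trans hcd.symm)
  subst hc
  exact ⟨f, hfI, hrank⟩

end Jacobian

end DualVariety

/-! ### Cones over projective sets -/

namespace DualVariety

open MvPolynomial

variable {K : Type*} [Field K] {N : ℕ}

theorem mem_coneIdeal {S : Set (Pr K N)} {f : MvPolynomial (Fin (N + 1)) K} :
    f ∈ coneIdeal S ↔ ∀ v ∈ affineCone S, aeval v f = 0 :=
  mem_vanishingIdeal_iff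

theorem mk_smul_eq {t : K} {v : Fin (N + 1) → K} (hv : v ≠ 0) (htv : t • v ≠ 0) :
    Projectivization.mk K (t • v) htv = Projectivization.mk K v hv :=
  (Projectivization.mk_eq_mk_iff' K _ _ htv hv).2 ⟨t, rfl⟩

theorem smul_mem_affineCone {S : Set (Pr K N)} {v : Fin (N + 1) → K} (hv : v ∈ affineCone S)
    (t : K) : t • v ∈ affineCone S := by
  intro h
  have hv0 : v ≠ 0 := fun h0 => h (by rw [h0, smul_zero])
  rw [mk_smul_eq hv0]
  exact hv hv0

theorem zero_mem_affineCone (S : Set (Pr K N)) : (0 : Fin (N + 1) → K) ∈ affineCone S :=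
  fun h => (h rfl).elim

theorem rep_mem_affineCone_iff {S : Set (Pr K N)} {p : Pr K N} :
    p.rep ∈ affineCone S ↔ p ∈ S := by
  constructor
  · intro h
    have := h p.rep_nonzero
    rwa [Projectivization.mk_rep] at this
  · intro h _
    rwa [Projectivization.mk_rep]

theorem exists_smul_rep_eq {v : Fin (N + 1) → K} (hv : v ≠ 0) :
    ∃ t : K, t ≠ 0 ∧ v = t • (Projectivization.mk K v hv).rep := by
  obtain ⟨a, ha⟩ := Projectivization.exists_smul_eq_mk_rep K v hv
  refine ⟨(a⁻¹ : Kˣ), Units.ne_zero _, ?_⟩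
  rw [← ha, Units.smul_def, smul_smul, Units.inv_mul, one_smul]

/-- The nonzero vectors of the affine cone. -/
def puncturedCone (S : Set (Pr K N)) : Set (Fin (N + 1) → K) :=
  {v | v ∈ affineCone S ∧ v ≠ 0}

/-- The substitution `x ↦ t • x`. -/
noncomputable def scale (t : K) :
    MvPolynomial (Fin (N + 1)) K →ₐ[K] MvPolynomial (Fin (N + 1)) K :=
  aeval fun i => C t * X i

theorem aeval_scale (t : K) (v : Fin (N + 1) → K) (f : MvPolynomial (Fin (N + 1)) K) :
    aeval v (scale t f) = aeval (t • v) f := by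
  have : ((aeval v).comp (scale t) : MvPolynomial (Fin (N + 1)) K →ₐ[K] K) = aeval (t • v) := by
    ext i
    simp [scale]
  exact DFunLike.congr_fun this f

theorem pderiv_scale (t : K) (i : Fin (N + 1)) (f : MvPolynomial (Fin (N + 1)) K) :
    pderiv i (scale t f) = C t * scale t (pderiv i f) := by
  induction f using MvPolynomial.induction_on with
  | C a => simp [scale]
  | add p q hp hq => rw [map_add, map_add, hp, hq, map_add, map_add, mul_add]
  | mul_X p j hp =>
    have hX : scale t (X j : MvPolynomial (Fin (N + 1)) K) = C t * X j := by simp [scale]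
    rw [map_mul, pderiv_mul, hp, hX, pderiv_mul, pderiv_mul, map_add, map_mul, map_mul, hX]
    by_cases hij : i = j
    · subst hij
      simp
      ring
    · simp [pderiv_X_of_ne (Ne.symm hij)]
      ring

theorem scale_mem_coneIdeal {S : Set (Pr K N)} {f : MvPolynomial (Fin (N + 1)) K}
    (hf : f ∈ coneIdeal S) (t : K) : scale t f ∈ coneIdeal S := by
  rw [mem_coneIdeal] at hf ⊢
  intro v hv
  rw [aeval_scale]
  exact hf _ (smul_mem_affineCone hv t)

/-- The restriction of a polynomial to the line through `v`. -/
noncomputable def onLine (v : Fin (N + 1) → K) :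
    MvPolynomial (Fin (N + 1)) K →ₐ[K] Polynomial K :=
  aeval fun i => Polynomial.C (v i) * Polynomial.X

theorem eval_onLine (v : Fin (N + 1) → K) (t : K) (f : MvPolynomial (Fin (N + 1)) K) :
    (onLine v f).eval t = aeval (t • v) f := by
  have : ((Polynomial.aeval t).comp (onLine v) : MvPolynomial (Fin (N + 1)) K →ₐ[K] K) =
      aeval (t • v) := by
    ext i
    simp only [AlgHom.comp_apply, onLine, aeval_X, Polynomial.coe_aeval_eq_eval,
      Polynomial.eval_mul, Polynomial.eval_C, Polynomial.eval_X, Pi.smul_apply, smul_eq_mul]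
    exact mul_comm _ _
  rw [← Polynomial.coe_aeval_eq_eval]
  exact DFunLike.congr_fun this f

theorem onLine_eq_zero_iff [Infinite K] {v : Fin (N + 1) → K} {f : MvPolynomial (Fin (N + 1)) K} :
    onLine v f = 0 ↔ ∀ t : K, t ≠ 0 → aeval (t • v) f = 0 := by
  constructor
  · intro h t _
    rw [← eval_onLine, h, Polynomial.eval_zero]
  · intro h
    refine Polynomial.eq_zero_of_infinite_isRoot _ (Set.Infinite.mono (s := {0}ᶜ) ?_ ?_)
    · intro t ht
      change (onLine v f).eval t = 0
      rw [eval_onLine]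
      exact h t ht
    · exact (Set.finite_singleton (0 : K)).infinite_compl

/-- The cone always contains the origin. Nonemptiness of S gives a line through it, so no separate
condition there is needed. -/
theorem mem_coneIdeal_iff_onLine [Infinite K] {S : Set (Pr K N)} (hS : S.Nonempty)
    {f : MvPolynomial (Fin (N + 1)) K} :
    f ∈ coneIdeal S ↔ ∀ p ∈ S, onLine p.rep f = 0 := by
  rw [mem_coneIdeal]
  constructor
  · intro h p hp
    rw [onLine_eq_zero_iff]
    exact fun t _ => h _ (smul_mem_affineCone (rep_mem_affineCone_iff.2 hp) t)
  · intro h v hv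
    by_cases hv0 : v = 0
    · obtain ⟨p, hp⟩ := hS
      have := eval_onLine p.rep 0 f
      rw [h p hp, zero_smul, Polynomial.eval_zero] at this
      rw [hv0, this]
    · obtain ⟨t, ht, htv⟩ := exists_smul_rep_eq hv0
      rw [htv]
      exact onLine_eq_zero_iff.1 (h _ (hv hv0)) t ht

theorem mem_coneIdeal_iff_puncturedCone [Infinite K] {S : Set (Pr K N)} (hS : S.Nonempty)
    {f : MvPolynomial (Fin (N + 1)) K} :
    f ∈ coneIdeal S ↔ ∀ v ∈ puncturedCone S, aeval v f = 0 := by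
  constructor
  · exact fun h v hv => mem_coneIdeal.1 h v hv.1
  · intro h
    rw [mem_coneIdeal_iff_onLine hS]
    intro p hp
    rw [onLine_eq_zero_iff]
    exact fun t ht => h _ ⟨smul_mem_affineCone (rep_mem_affineCone_iff.2 hp) t,
      smul_ne_zero ht p.rep_nonzero⟩

theorem mem_zariskiClosure {S : Set (Pr K N)} {p : Pr K N} :
    p ∈ zariskiClosure S ↔ ∀ f ∈ coneIdeal S, aeval p.rep f = 0 :=
  Iff.rfl

theorem coneIdeal_zariskiClosure (S : Set (Pr K N)) :
    coneIdeal (zariskiClosure S) = coneIdeal S := by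
  apply le_antisymm
  · intro f hf
    rw [mem_coneIdeal] at hf ⊢
    intro v hv
    refine hf v fun hv0 g hg => ?_
    exact mem_coneIdeal.1 hg _ (rep_mem_affineCone_iff.2 (hv hv0))
  · intro f hf
    rw [mem_coneIdeal]
    intro v hv
    by_cases hv0 : v = 0
    · subst hv0
      exact mem_coneIdeal.1 hf _ (zero_mem_affineCone S)
    · obtain ⟨t, -, htv⟩ := exists_smul_rep_eq hv0
      rw [htv, ← aeval_scale]
      exact mem_zariskiClosure.1 (hv hv0) _ (scale_mem_coneIdeal hf t)

theorem isZariskiClosed_zariskiClosure (S : Set (Pr K N)) : IsZariskiClosed (zariskiClosure S) := by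
  unfold IsZariskiClosed
  ext p
  rw [mem_zariskiClosure, coneIdeal_zariskiClosure, mem_zariskiClosure]

theorem subset_zariskiClosure (S : Set (Pr K N)) : S ⊆ zariskiClosure S := fun _ hp _ hf =>
  mem_coneIdeal.1 hf _ (rep_mem_affineCone_iff.2 hp)

theorem zariskiClosure_empty : zariskiClosure (∅ : Set (Pr K N)) = ∅ := by
  ext p
  refine ⟨fun hp => p.rep_nonzero (funext fun i => ?_), fun h => h.elim⟩
  have h : (X i : MvPolynomial (Fin (N + 1)) K) ∈ coneIdeal (∅ : Set (Pr K N)) := by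
    rw [mem_coneIdeal]
    intro v hv
    have hv0 : v = 0 := by
      by_contra h
      exact hv h
    simp [hv0]
  simpa using mem_zariskiClosure.1 hp _ h

theorem IsVariety.mem_coneIdeal_of_subset [Infinite K] {X S : Set (Pr K N)} (hX : IsVariety X)
    (h : X ⊆ zariskiClosure S) {f : MvPolynomial (Fin (N + 1)) K}
    (hf : ∀ p ∈ S, onLine p.rep f = 0) : f ∈ coneIdeal X := by
  have hS : S.Nonempty := by
    by_contra hne
    rw [Set.not_nonempty_iff_eq_empty] at hne
    obtain ⟨p, hp⟩ := hX.nonempty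
    have := h hp
    rw [hne, zariskiClosure_empty] at this
    exact this
  have hfS := (mem_coneIdeal_iff_onLine hS).2 hf
  rw [← coneIdeal_zariskiClosure, mem_coneIdeal] at hfS
  rw [mem_coneIdeal]
  exact fun v hv => hfS v fun hv0 => h (hv hv0)

/-- The polynomials need not be homogeneous, so they are restricted to the lines of the cone. If fg
vanishes on a line, so does f or g, since K[t] is a domain; irreducibility then makes one choice
work for all of X. -/
theorem IsVariety.isPrime [Infinite K] {X : Set (Pr K N)} (hX : IsVariety X) :
    (coneIdeal X).IsPrime := by
  refine ⟨?_, fun {f g} hfg => ?_⟩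
  · rw [Ideal.ne_top_iff_one, mem_coneIdeal]
    intro h
    have := h 0 (zero_mem_affineCone X)
    rw [map_one] at this
    exact one_ne_zero this
  · rw [mem_coneIdeal_iff_onLine hX.nonempty] at hfg
    rcases hX.irreducible (zariskiClosure {p | p ∈ X ∧ onLine p.rep f = 0})
      (zariskiClosure {p | p ∈ X ∧ onLine p.rep g = 0}) (isZariskiClosed_zariskiClosure _)
      (isZariskiClosed_zariskiClosure _) (by
        intro p hp
        have := hfg p hp
        rw [map_mul, mul_eq_zero] at this
        exact this.imp (fun h => subset_zariskiClosure _ ⟨hp, h⟩)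
          (fun h => subset_zariskiClosure _ ⟨hp, h⟩)) with h | h
    · exact Or.inl (hX.mem_coneIdeal_of_subset h fun p hp => hp.2)
    · exact Or.inr (hX.mem_coneIdeal_of_subset h fun p hp => hp.2)

/-- Differentiate f(tv) = 0 in t at t = 1; this replaces Euler's formula for inhomogeneous f. -/
theorem sum_X_mul_pderiv_mem_coneIdeal [Infinite K] {S : Set (Pr K N)}
    {f : MvPolynomial (Fin (N + 1)) K} (hf : f ∈ coneIdeal S) :
    ∑ i, X i * pderiv i f ∈ coneIdeal S := by
  rw [mem_coneIdeal]
  intro v hv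
  have h0 : onLine v f = 0 :=
    onLine_eq_zero_iff.2 fun t _ => mem_coneIdeal.1 hf _ (smul_mem_affineCone hv t)
  have h1 := derivation_aeval (K := K) (Polynomial.derivative' (R := K))
    (fun i => Polynomial.C (v i) * Polynomial.X) f
  have h2 : aeval (fun i => Polynomial.C (v i) * Polynomial.X) f = (0 : Polynomial K) := h0
  rw [h2, map_zero] at h1
  have h3 := congrArg (Polynomial.eval 1) h1
  rw [Polynomial.eval_zero, Polynomial.eval_finsetSum] at h3
  have h4 : ∀ g : MvPolynomial (Fin (N + 1)) K,
      (aeval (fun i => Polynomial.C (v i) * Polynomial.X) g : Polynomial K).eval 1 =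
      aeval v g := by
    intro g
    have := eval_onLine v 1 g
    rwa [one_smul] at this
  rw [map_sum, h3]
  refine Finset.sum_congr rfl fun i _ => ?_
  rw [Polynomial.eval_mul, h4, map_mul, aeval_X, mul_comm]
  congr 1
  simp

/-! ### Tangent spaces and displacements in terms of Jacobians -/

theorem tangentSpace_eq_tangentAt (X : Set (Pr K N)) (x : Pr K N) :
    tangentSpace X x = tangentAt (coneIdeal X) x.rep :=
  rfl

theorem tangentAt_smul (S : Set (Pr K N)) {t : K} (ht : t ≠ 0) (v : Fin (N + 1) → K) :
    tangentAt (coneIdeal S) (t • v) = tangentAt (coneIdeal S) v := by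
  have key : ∀ (t : K) (v : Fin (N + 1) → K), t ≠ 0 →
      tangentAt (coneIdeal S) v ≤ tangentAt (coneIdeal S) (t • v) := by
    intro t v ht w hw f hf
    have := hw _ (scale_mem_coneIdeal hf t)
    simp only [pderiv_scale, map_mul, aeval_scale, algHom_C, Algebra.algebraMap_self,
      RingHom.id_apply, mul_assoc, ← Finset.mul_sum] at this
    exact (mul_eq_zero.1 this).resolve_left ht
  refine le_antisymm ?_ (key t v ht)
  have := key t⁻¹ (t • v) (inv_ne_zero ht)
  rwa [smul_smul, inv_mul_cancel₀ ht, one_smul] at this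

theorem pderiv_pderiv_comm {R σ : Type*} [CommRing R] (i j : σ) (f : MvPolynomial σ R) :
    pderiv i (pderiv j f) = pderiv j (pderiv i f) := by
  classical
  let D : σ → Derivation R (MvPolynomial σ R) (MvPolynomial σ R) := fun i => pderiv i
  have h : ⁅D i, D j⁆ = 0 := by
    refine derivation_ext (R := R) fun k => ?_
    simp [D, Derivation.commutator_apply, pderiv_X, Pi.single_apply, apply_ite]
  have := DFunLike.congr_fun h f
  rwa [Derivation.commutator_apply, Derivation.zero_apply, sub_eq_zero] at this

/-- The tangent space is constant along the line of the cone. Concretely, the tangent equation of ∑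
Xᵢ ∂ᵢf, minus that of f, is the required second-order equation. -/
theorem rep_mem_gaussKernel [Infinite K] {X : Set (Pr K N)} {x : Pr K N} (hx : x ∈ X) :
    x.rep ∈ gaussKernel X x := by
  have hE : ∀ f ∈ coneIdeal X, aeval x.rep f = 0 := fun f hf =>
    mem_coneIdeal.1 hf _ (rep_mem_affineCone_iff.2 hx)
  refine ⟨fun f hf => ?_, fun w hw f hf => ?_⟩
  · have := hE _ (sum_X_mul_pderiv_mem_coneIdeal hf)
    simp only [map_sum, map_mul, aeval_X] at this
    rw [← this]
    exact Finset.sum_congr rfl fun i _ => mul_comm _ _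
  · have h1 := (mem_tangentAt.1 hw) _ (sum_X_mul_pderiv_mem_coneIdeal hf)
    have h2 := (mem_tangentAt.1 hw) f hf
    have h3 : ∀ j, aeval x.rep (pderiv j (∑ i, MvPolynomial.X i * pderiv i f)) =
        aeval x.rep (pderiv j f) + ∑ i, x.rep i * aeval x.rep (pderiv j (pderiv i f)) := by
      intro j
      have h4 : ∀ i, aeval x.rep (pderiv j (MvPolynomial.X i * pderiv i f)) =
          (if i = j then aeval x.rep (pderiv j f) else 0) +
            x.rep i * aeval x.rep (pderiv j (pderiv i f)) := by
        intro i
        by_cases hij : i = j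
        · subst hij
          simp
          ring
        · simp [pderiv_X_of_ne hij, hij]
      rw [map_sum, map_sum, Finset.sum_congr rfl fun i _ => h4 i, Finset.sum_add_distrib]
      simp
    simp only [h3, add_mul, Finset.sum_add_distrib, h2, zero_add] at h1
    simp only [Pi.zero_apply, mul_zero, Finset.sum_const_zero, add_zero]
    rw [Finset.sum_comm, ← h1]
    refine Finset.sum_congr rfl fun j _ => ?_
    rw [Finset.sum_mul]
    refine Finset.sum_congr rfl fun i _ => ?_
    change aeval x.rep (pderiv i (pderiv j f)) * x.rep i * w j = _
    rw [pderiv_pderiv_comm]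
    ring

end DualVariety

/-! ### Generic points -/

namespace DualVariety

open MvPolynomial Matrix

section Generic

variable {K L σ : Type*} [Field K] [Field L] [Algebra K L] [Fintype σ]

theorem rank_jacobian_le_of_generic {I : Ideal (MvPolynomial σ K)} {x : σ → L}
    (hx : ∀ f, aeval x f = 0 ↔ f ∈ I) {y : σ → K} (hy : ∀ f ∈ I, aeval y f = 0) {c : ℕ}
    (f : Fin c → MvPolynomial σ K) : (jacobian f y).rank ≤ (jacobian f x).rank := by
  rw [← jacobianPoly_map f y, ← jacobianPoly_map f x]
  exact rank_map_le_of_ker_le _ _ _ fun g hg => hy g ((hx g).1 hg)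

theorem tangentAt_eq_ker_jacobian {A : Type*} [Field A] [Algebra K A]
    {I : Ideal (MvPolynomial σ K)} {y : σ → A} {c d : ℕ} {f : Fin c → MvPolynomial σ K}
    (hf : ∀ a, f a ∈ I) (hrank : (jacobian f y).rank = c)
    (hd : Module.finrank A (tangentAt I y) = d) (hcd : c + d = Fintype.card σ) :
    tangentAt I y = LinearMap.ker (jacobian f y).mulVecLin := by
  apply Submodule.eq_of_le_of_finrank_eq (tangentAt_le_ker_jacobian hf y)
  have := finrank_ker_mulVecLin (jacobian f y)
  omega

/-- At a point where `c` equations of the ideal, `c` the codimension, are independent, there is a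
matrix `P` of polynomials whose columns are tangent at all points and which restricts to the
identity on the kernel of the Jacobian at the given point. -/
theorem exists_tangent_projection {I : Ideal (MvPolynomial σ K)} {x : σ → L}
    (hx : ∀ f, aeval x f = 0 ↔ f ∈ I) {y : σ → K} (hy : ∀ f ∈ I, aeval y f = 0) {c d : ℕ}
    (hd : Module.finrank L (tangentAt I x) = d) (hcd : c + d = Fintype.card σ)
    {f : Fin c → MvPolynomial σ K} (hf : ∀ a, f a ∈ I) (hrank : (jacobian f y).rank = c) :
    ∃ P : Matrix σ σ (MvPolynomial σ K), (∀ g ∈ I, ∀ j, ∑ i, pderiv i g * P i j ∈ I) ∧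
      ∀ v, jacobian f y *ᵥ v = 0 → (P.map (aeval y)) *ᵥ v = v := by
  classical
  have hxrank : (jacobian f x).rank = c := by
    refine le_antisymm ?_ (hrank.symm.le.trans (rank_jacobian_le_of_generic hx hy f))
    simpa using Matrix.rank_le_card_height (jacobian f x)
  have hTx := tangentAt_eq_ker_jacobian hf hxrank hd hcd
  obtain ⟨R, hR⟩ := Matrix.mulVec_surjective_iff_exists_right_inverse.1
    (mulVecLin_surjective_of_rank (jacobian f y) (by rw [hrank, Fintype.card_fin]))
  let J := jacobianPoly f
  let R' : Matrix σ (Fin c) (MvPolynomial σ K) := R.map C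
  let B := J * R'
  -- The projection 1 - R(JR)⁻¹J onto ker J along R, with denominators cleared by det(JR). At `y`
  -- one has JR = 1, so P becomes 1 - RJ.
  let P : Matrix σ σ (MvPolynomial σ K) := B.det • 1 - R' * B.adjugate * J
  have hJP : J * P = 0 := by
    change J * (B.det • 1 - R' * B.adjugate * J) = 0
    rw [Matrix.mul_sub, Matrix.mul_smul, Matrix.mul_one, ← Matrix.mul_assoc, ← Matrix.mul_assoc,
      show J * R' = B from rfl, Matrix.mul_adjugate, Matrix.smul_mul, Matrix.one_mul, sub_self]
  refine ⟨P, fun g hg j => ?_, fun v hv => ?_⟩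
  · have hcol : (fun i => aeval x (P i j)) ∈ tangentAt I x := by
      rw [hTx, LinearMap.mem_ker]
      ext a
      have := congrArg (aeval x) (congrFun (congrFun hJP a) j)
      rw [Matrix.mul_apply, map_sum] at this
      simpa [jacobian, J, jacobianPoly, Matrix.mulVec, dotProduct] using this
    rw [← hx, map_sum, ← hcol g hg]
    simp
  · let φ : MvPolynomial σ K →+* K := (aeval y : MvPolynomial σ K →ₐ[K] K).toRingHom
    have hJ : J.map φ = jacobian f y := rfl
    have hR' : R'.map φ = R := by
      ext i a
      simp [R', φ]
    have hB : B.map φ = 1 := by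
      rw [Matrix.map_mul, hJ, hR', hR]
    have hdet : φ B.det = 1 := by
      rw [RingHom.map_det, RingHom.mapMatrix_apply, hB, det_one]
    have hP : P.map φ = 1 - R * (B.adjugate.map φ) * jacobian f y := by
      have h1 : P.map φ = (B.det • (1 : Matrix σ σ (MvPolynomial σ K))).map φ
          - (R' * B.adjugate * J).map φ := Matrix.map_sub _ (map_sub φ) _ _
      rw [h1, Matrix.map_mul, Matrix.map_mul, hJ, hR']
      congr 1
      ext i j
      simp [Matrix.one_apply, apply_ite φ, hdet]
    change P.map φ *ᵥ v = v
    rw [hP, Matrix.sub_mulVec, one_mulVec, ← Matrix.mulVec_mulVec, hv, mulVec_zero, sub_zero]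

/-- The columns of P are tangent at `y` by specialization, and P fixes ker J pointwise; so c
independent gradients at `y` already force smoothness. -/
theorem tangentAt_eq_ker_jacobian_of_rank {I : Ideal (MvPolynomial σ K)} {x : σ → L}
    (hx : ∀ f, aeval x f = 0 ↔ f ∈ I) {y : σ → K} (hy : ∀ f ∈ I, aeval y f = 0) {c d : ℕ}
    (hd : Module.finrank L (tangentAt I x) = d) (hcd : c + d = Fintype.card σ)
    {f : Fin c → MvPolynomial σ K} (hf : ∀ a, f a ∈ I) (hrank : (jacobian f y).rank = c) :
    tangentAt I y = LinearMap.ker (jacobian f y).mulVecLin := by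
  obtain ⟨P, hP, hPv⟩ := exists_tangent_projection hx hy hd hcd hf hrank
  refine le_antisymm (tangentAt_le_ker_jacobian hf y) fun v hv g hg => ?_
  rw [← hPv v hv]
  simp only [Matrix.mulVec, dotProduct, Matrix.map_apply, Finset.mul_sum]
  rw [Finset.sum_comm]
  refine Finset.sum_eq_zero fun j _ => ?_
  have := hy _ (hP g hg j)
  simp only [map_sum, map_mul] at this
  simp only [← mul_assoc, ← Finset.sum_mul, this, zero_mul]

/-- Tangent vectors can be displaced along tangent directions. -/
theorem exists_displacement {I : Ideal (MvPolynomial σ K)} {x : σ → L}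
    (hx : ∀ f, aeval x f = 0 ↔ f ∈ I) {y : σ → K} (hy : ∀ f ∈ I, aeval y f = 0) {c d : ℕ}
    (hd : Module.finrank L (tangentAt I x) = d) (hcd : c + d = Fintype.card σ)
    {f : Fin c → MvPolynomial σ K} (hf : ∀ a, f a ∈ I) (hrank : (jacobian f y).rank = c)
    {v w : σ → K} (hv : v ∈ tangentAt I y) (hw : w ∈ tangentAt I y) :
    ∃ u : σ → K, ∀ g ∈ I, ∑ i, ∑ j, aeval y (pderiv i (pderiv j g)) * v i * w j
      + ∑ i, aeval y (pderiv i g) * u i = 0 := by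
  obtain ⟨P, hP, hPv⟩ := exists_tangent_projection hx hy hd hcd hf hrank
  have hPw := hPv w (tangentAt_le_ker_jacobian hf y hw)
  -- The field P w is tangent everywhere and equals w at `y`; u is its derivative along v.
  refine ⟨fun i => ∑ j, ∑ k, aeval y (pderiv k (P i j)) * v k * w j, fun g hg => ?_⟩
  have h1 : ∀ j, ∑ k, (∑ i, (aeval y (pderiv k (pderiv i g)) * aeval y (P i j)
      + aeval y (pderiv i g) * aeval y (pderiv k (P i j)))) * v k = 0 := by
    intro j
    rw [← hv _ (hP g hg j)]
    refine Finset.sum_congr rfl fun k _ => ?_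
    simp only [map_sum, pderiv_mul, map_add, map_mul]
  have h2 : ∑ j, w j * ∑ k, (∑ i, (aeval y (pderiv k (pderiv i g)) * aeval y (P i j)
      + aeval y (pderiv i g) * aeval y (pderiv k (P i j)))) * v k = 0 := by
    simp only [h1, mul_zero, Finset.sum_const_zero]
  have h3 : ∀ i, w i = ∑ j, aeval y (P i j) * w j := fun i => (congrFun hPw i).symm
  have h4 : ∑ k, ∑ i, aeval y (pderiv k (pderiv i g)) * v k * w i =
      ∑ j, w j * ∑ k, (∑ i, aeval y (pderiv k (pderiv i g)) * aeval y (P i j)) * v k := by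
    conv_lhs =>
      enter [2, k, 2, i]
      rw [h3 i]
    simp only [Finset.mul_sum, Finset.sum_mul]
    rw [Finset.sum_comm' (t' := Finset.univ) (s' := fun _ => Finset.univ) (by simp)]
    rw [Finset.sum_congr rfl fun i _ => Finset.sum_comm, Finset.sum_comm]
    refine Finset.sum_congr rfl fun j _ => ?_
    rw [Finset.sum_comm]
    refine Finset.sum_congr rfl fun k _ => Finset.sum_congr rfl fun i _ => ?_
    ring
  have h5 : ∑ i, aeval y (pderiv i g) * (∑ j, ∑ k, aeval y (pderiv k (P i j)) * v k * w j) =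
      ∑ j, w j * ∑ k, (∑ i, aeval y (pderiv i g) * aeval y (pderiv k (P i j))) * v k := by
    simp only [Finset.mul_sum, Finset.sum_mul]
    rw [Finset.sum_comm]
    refine Finset.sum_congr rfl fun j _ => ?_
    rw [Finset.sum_comm]
    refine Finset.sum_congr rfl fun k _ => Finset.sum_congr rfl fun i _ => ?_
    ring
  rw [h4, h5, ← Finset.sum_add_distrib, ← h2]
  refine Finset.sum_congr rfl fun j _ => ?_
  simp only [Finset.sum_add_distrib, add_mul, mul_add]

end Generic

end DualVariety

/-! ### The generic point of the dual variety -/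

namespace DualVariety

open MvPolynomial Matrix

section Generic

variable {K F L σ : Type*} [Field K] [Field F] [Field L] [Algebra K F] [Algebra F L] [Algebra K L]
  [IsScalarTower K F L]

theorem aeval_comp_algebraMap_eq_zero (x : σ → F) (f : MvPolynomial σ K) :
    aeval (algebraMap F L ∘ x) f = 0 ↔ aeval x f = 0 := by
  rw [aeval_algebraMap_apply, map_eq_zero]

/-- A generic point of `V` together with independent indeterminates is a generic point of the
product of `V` with an affine space. -/
theorem aeval_elim_eq_zero_iff [Infinite K] {V : Set (σ → K)} {x : σ → F}
    (hx : ∀ f : MvPolynomial σ K, aeval x f = 0 ↔ ∀ p ∈ V, aeval p f = 0)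
    {ι : Type*} {s : ι → L} (hs : AlgebraicIndependent F s) (G : MvPolynomial (σ ⊕ ι) K) :
    aeval (Sum.elim (algebraMap F L ∘ x) s) G = 0 ↔
      ∀ p ∈ V, ∀ t : ι → K, aeval (Sum.elim p t) G = 0 := by
  let Gx : MvPolynomial ι F := aeval (Sum.elim (fun i => C (x i)) X) G
  have h1 : aeval (Sum.elim (algebraMap F L ∘ x) s) G = aeval s Gx := by
    have : (aeval (Sum.elim (algebraMap F L ∘ x) s) : MvPolynomial (σ ⊕ ι) K →ₐ[K] L) =
        ((aeval s : MvPolynomial ι F →ₐ[F] L).restrictScalars K).comp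
          (aeval (Sum.elim (fun i => C (x i)) X)) := by
      ext i
      rcases i with i | i <;> simp
    exact DFunLike.congr_fun this G
  have h2 : ∀ t : ι → K, eval (algebraMap K F ∘ t) Gx =
      aeval x (aeval (Sum.elim X fun a => C (t a)) G : MvPolynomial σ K) := by
    intro t
    have : ((aeval (algebraMap K F ∘ t) : MvPolynomial ι F →ₐ[F] F).restrictScalars K).comp
          (aeval (Sum.elim (fun i => C (x i)) X) : MvPolynomial (σ ⊕ ι) K →ₐ[K] MvPolynomial ι F) =
        (aeval x : MvPolynomial σ K →ₐ[K] F).comp (aeval (Sum.elim X fun a => C (t a))) := by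
      ext i
      rcases i with i | i <;> simp
    exact DFunLike.congr_fun this G
  have h3 : ∀ (p : σ → K) (t : ι → K),
      aeval p (aeval (Sum.elim X fun a => C (t a)) G : MvPolynomial σ K) =
        aeval (Sum.elim p t) G := by
    intro p t
    have : (aeval p : MvPolynomial σ K →ₐ[K] K).comp (aeval (Sum.elim X fun a => C (t a))) =
        aeval (Sum.elim p t) := by
      ext i
      rcases i with i | i <;> simp
    exact DFunLike.congr_fun this G
  rw [h1]
  constructor
  · intro h p hp t
    have h0 : Gx = 0 := (injective_iff_map_eq_zero _).1 hs _ h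
    have := h2 t
    rw [h0, map_zero] at this
    rw [← h3]
    exact (hx _).1 this.symm p hp
  · intro h
    have h0 : Gx = 0 := by
      -- K is infinite, so a polynomial over F that vanishes at all K-points is zero.
      refine funext_set (fun _ => Set.range (algebraMap K F))
        (fun _ => Set.infinite_range_of_injective (algebraMap K F).injective) fun y hy => ?_
      choose t ht using fun a => hy a (Set.mem_univ a)
      obtain rfl : algebraMap K F ∘ t = y := funext ht
      rw [h2, map_zero, hx]
      intro p hp
      rw [h3]
      exact h p hp t
    rw [h0, map_zero]

/-- The dimension of the cone over the dual variety is the dimension of the space of tangent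
vectors to the generic conormal covector `Jᵀ s`. -/
theorem toNat_trdeg_conormal [CharZero K] [Fintype σ] {I : Ideal (MvPolynomial σ K)} {x : σ → F}
    (hx : ∀ f, aeval x f = 0 ↔ f ∈ I) {c d : ℕ} {s : Fin c → L}
    (hs : AlgebraicIndependent F s)
    (hd : Module.finrank L (tangentAt I (algebraMap F L ∘ x)) = d) (hcd : c + d = Fintype.card σ)
    {f : Fin c → MvPolynomial σ K} (hf : ∀ a, f a ∈ I)
    (hrank : (jacobian f (algebraMap F L ∘ x)).rank = c) {Q : Ideal (MvPolynomial σ K)}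
    (hQ : ∀ g, aeval ((jacobian f (algebraMap F L ∘ x))ᵀ *ᵥ s) g = 0 ↔ g ∈ Q) :
    Cardinal.toNat (Algebra.trdeg K (MvPolynomial σ K ⧸ Q)) =
      Module.finrank L (borderedImage (hessian f (algebraMap F L ∘ x) s)
        (jacobian f (algebraMap F L ∘ x))) := by
  have : CharZero F := charZero_of_injective_algebraMap (algebraMap K F).injective
  have : CharZero L := charZero_of_injective_algebraMap (algebraMap K L).injective
  rw [toNat_trdeg_quotient hQ]
  set y := algebraMap F L ∘ x with hy
  have hyI : ∀ f, aeval y f = 0 ↔ f ∈ I := fun f =>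
    (aeval_comp_algebraMap_eq_zero x f).trans (hx f)
  have hT := tangentAt_eq_ker_jacobian hf hrank hd hcd
  -- The Leibniz and chain rules: D(Jᵀs) = Jᵀ D(s) + H D(y).
  have hD : ∀ D : Derivation K L L, (fun i => D (((jacobian f y)ᵀ *ᵥ s) i)) =
      (jacobian f y)ᵀ *ᵥ (fun a => D (s a)) + hessian f y s *ᵥ fun j => D (y j) := by
    intro D
    ext i
    simp only [Matrix.mulVec, dotProduct, jacobian, hessian, transpose_apply, of_apply,
      Pi.add_apply, map_sum, Derivation.leibniz, derivation_aeval, smul_eq_mul, Finset.mul_sum,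
      Finset.sum_add_distrib, Finset.sum_mul]
    congr 1
    rw [Finset.sum_comm]
    refine Finset.sum_congr rfl fun j _ => Finset.sum_congr rfl fun a _ => ?_
    rw [pderiv_pderiv_comm]
    ring
  suffices h : tangentAt Q ((jacobian f y)ᵀ *ᵥ s) =
      borderedImage (hessian f y s) (jacobian f y) by rw [h]
  ext η
  rw [mem_tangentAt_iff_exists_derivation hQ]
  constructor
  · rintro ⟨D, hDη⟩
    obtain rfl : (fun i => D (((jacobian f y)ᵀ *ᵥ s) i)) = η := funext hDη
    rw [hD]
    refine Submodule.add_mem_sup (LinearMap.mem_range_self (jacobian f y)ᵀ.mulVecLin _)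
      (Submodule.mem_map_of_mem (f := (hessian f y s).mulVecLin) ?_)
    rw [← hT]
    exact (mem_tangentAt_iff_exists_derivation hyI).2 ⟨D, fun _ => rfl⟩
  · intro h
    obtain ⟨_, ⟨a, rfl⟩, _, ⟨v, hv, rfl⟩, rfl⟩ := Submodule.mem_sup.1 h
    rw [SetLike.mem_coe, ← hT] at hv
    obtain ⟨D₁, hD₁⟩ := (mem_tangentAt_iff_exists_derivation hyI).1 hv
    -- `D₂` is F-linear, so it corrects the values on `s` without changing those on `y`.
    obtain ⟨D₂, hD₂⟩ := exists_derivation (K := F) s (fun b => a b - D₁ (s b)) (by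
      intro g hg
      have : g = 0 := (injective_iff_map_eq_zero _).1 hs g hg
      simp [this])
    refine ⟨D₁ + D₂.restrictScalars K, fun i => ?_⟩
    have h1 : (fun b => (D₁ + D₂.restrictScalars K) (s b)) = a := by
      ext b
      simp [hD₂]
    have h2 : (fun j => (D₁ + D₂.restrictScalars K) (y j)) = v := by
      ext j
      have : D₁ (algebraMap F L (x j)) = v j := hD₁ j
      simp [hy, this]
    have := congrFun (hD (D₁ + D₂.restrictScalars K)) i
    rw [h1, h2] at this
    exact this

end Generic

section ConormalPoly

variable {K σ ι : Type*} [Field K] [Fintype ι]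

/-- The composition of the polynomial `g` with the universal conormal covector `Jᵀ s`. -/
noncomputable def conormalPoly (f : ι → MvPolynomial σ K) (g : MvPolynomial σ K) :
    MvPolynomial (σ ⊕ ι) K :=
  aeval (fun i => ∑ a, rename Sum.inl (pderiv i (f a)) * X (Sum.inr a)) g

theorem aeval_conormalPoly {A : Type*} [Field A] [Algebra K A] (f : ι → MvPolynomial σ K)
    (g : MvPolynomial σ K) (p : σ → A) (t : ι → A) :
    aeval (Sum.elim p t) (conormalPoly f g) = aeval ((jacobian f p)ᵀ *ᵥ t) g := by
  have : (aeval (Sum.elim p t)).comp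
      (aeval fun i => ∑ a, rename Sum.inl (pderiv i (f a)) * X (Sum.inr a)) =
      (aeval ((jacobian f p)ᵀ *ᵥ t) : MvPolynomial σ K →ₐ[K] A) := by
    ext i
    simp [aeval_elim_rename_inl, Matrix.mulVec, dotProduct, jacobian]
  exact DFunLike.congr_fun this g

end ConormalPoly

/-! ### Conormal covectors and the ideal of the dual variety. -/

section Dual

variable {K : Type*} [Field K] {N : ℕ}

theorem mem_smoothLocus_iff {X : Set (Pr K N)} {n : ℕ} (hn : projDim X = n) {x : Pr K N} :
    x ∈ smoothLocus X ↔
      x ∈ X ∧ Module.finrank K (tangentAt (coneIdeal X) x.rep) = n + 1 := by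
  change x ∈ X ∧ (Module.finrank K (tangentSpace X x) : ℤ) - 1 = projDim X ↔ _
  rw [hn, tangentSpace_eq_tangentAt]
  refine and_congr_right fun _ => ?_
  omega

theorem mk_mem_smoothLocus {X : Set (Pr K N)} {n : ℕ} (hn : projDim X = n)
    {p : Fin (N + 1) → K} (hp : p ∈ puncturedCone X)
    (hT : Module.finrank K (tangentAt (coneIdeal X) p) = n + 1) :
    Projectivization.mk K p hp.2 ∈ smoothLocus X ∧
      tangentSpace X (Projectivization.mk K p hp.2) = tangentAt (coneIdeal X) p := by
  obtain ⟨t, ht, htp⟩ := exists_smul_rep_eq hp.2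
  have h : tangentSpace X (Projectivization.mk K p hp.2) = tangentAt (coneIdeal X) p := by
    rw [tangentSpace_eq_tangentAt, ← tangentAt_smul X ht, ← htp]
  refine ⟨(mem_smoothLocus_iff hn).2 ⟨hp.1 hp.2, ?_⟩, h⟩
  rw [← tangentSpace_eq_tangentAt, h, hT]

theorem mem_affineCone_tangentHyperplanes {X : Set (Pr K N)} {x : Pr K N} (hx : x ∈ smoothLocus X)
    {η : Fin (N + 1) → K} (hη : ∀ v ∈ tangentSpace X x, η ⬝ᵥ v = 0) :
    η ∈ affineCone (tangentHyperplanes X) := by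
  intro h0
  refine ⟨x, hx, fun v hv => ?_⟩
  obtain ⟨a, ha⟩ := Projectivization.exists_smul_eq_mk_rep K η h0
  rw [← ha]
  change (a • η) ⬝ᵥ v = 0
  rw [Units.smul_def, smul_dotProduct, hη v hv, smul_zero]

theorem exists_dotProduct_eq_zero_of_mem_affineCone {X : Set (Pr K N)} {η : Fin (N + 1) → K}
    (hη : η ∈ affineCone (tangentHyperplanes X)) (h0 : η ≠ 0) :
    ∃ x ∈ smoothLocus X, ∀ v ∈ tangentSpace X x, η ⬝ᵥ v = 0 := by
  obtain ⟨x, hx, h⟩ := hη h0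
  refine ⟨x, hx, fun v hv => ?_⟩
  obtain ⟨t, -, ht⟩ := exists_smul_rep_eq h0
  rw [ht, smul_dotProduct]
  exact (congrArg (t • ·) (h v hv)).trans (smul_zero t)

variable {F L : Type*} [Field F] [Field L] [Algebra K F] [Algebra F L] [Algebra K L]
  [IsScalarTower K F L]

/-- If `J` is the Jacobian, at the generic point of `X`, of equations that define the tangent
space, and the `s` are indeterminates, then `Jᵀ s` is a generic point of the dual variety. -/
theorem aeval_conormal_eq_zero_iff [CharZero K] {X : Set (Pr K N)} (hX : IsVariety X) {n c : ℕ}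
    (hn : projDim X = n) (hcn : c + (n + 1) = N + 1) {x : Fin (N + 1) → F}
    (hx : ∀ f, aeval x f = 0 ↔ f ∈ coneIdeal X) {s : Fin c → L} (hs : AlgebraicIndependent F s)
    (hd : Module.finrank L (tangentAt (coneIdeal X) (algebraMap F L ∘ x)) = n + 1)
    {f : Fin c → MvPolynomial (Fin (N + 1)) K} (hf : ∀ a, f a ∈ coneIdeal X)
    (hrank : (jacobian f (algebraMap F L ∘ x)).rank = c) (g : MvPolynomial (Fin (N + 1)) K) :
    aeval ((jacobian f (algebraMap F L ∘ x))ᵀ *ᵥ s) g = 0 ↔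
      g ∈ coneIdeal (tangentHyperplanes X) := by
  set y := algebraMap F L ∘ x with hy
  have hcd : c + (n + 1) = Fintype.card (Fin (N + 1)) := by rw [Fintype.card_fin, hcn]
  have hyI : ∀ f, aeval y f = 0 ↔ f ∈ coneIdeal X := fun f =>
    (aeval_comp_algebraMap_eq_zero x f).trans (hx f)
  have hgen := aeval_elim_eq_zero_iff (L := L) (V := puncturedCone X)
    (fun f => (hx f).trans (mem_coneIdeal_iff_puncturedCone hX.nonempty)) hs
  have hpv : ∀ p ∈ puncturedCone X, ∀ f ∈ coneIdeal X, aeval p f = 0 := fun p hp f hf =>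
    mem_coneIdeal.1 hf p hp.1
  have hfK : c ≤ ((jacobianPoly f).map (aeval y : _ →ₐ[K] L).toRingHom).rank := hrank.symm.le
  obtain ⟨δ, hδ, hδK⟩ := exists_le_rank_map_of_ne_zero (B := K) _ _ hfK
  have hδI : δ ∉ coneIdeal X := fun h => hδ ((hyI δ).2 h)
  have hreg : ∀ p ∈ puncturedCone X, aeval p δ ≠ 0 →
      tangentAt (coneIdeal X) p = LinearMap.ker (jacobian f p).mulVecLin ∧
      Module.finrank K (tangentAt (coneIdeal X) p) = n + 1 := by
    intro p hp hpδ
    have h1 : c ≤ (jacobian f p).rank := hδK (aeval p : _ →ₐ[K] K).toRingHom hpδ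
    have h2 : (jacobian f p).rank = c :=
      le_antisymm (by simpa using Matrix.rank_le_card_height (jacobian f p)) h1
    have h3 := tangentAt_eq_ker_jacobian_of_rank hyI (hpv p hp) hd hcd hf h2
    refine ⟨h3, ?_⟩
    have := finrank_ker_mulVecLin (jacobian f p)
    rw [h3]
    omega
  rw [← aeval_conormalPoly, hgen]
  simp only [aeval_conormalPoly]
  constructor
  · intro h
    rw [mem_coneIdeal]
    intro η hη
    by_cases h0 : η = 0
    · obtain ⟨p, hp⟩ := hX.nonempty
      have := h p.rep ⟨rep_mem_affineCone_iff.2 hp, p.rep_nonzero⟩ 0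
      rwa [mulVec_zero, ← h0] at this
    · obtain ⟨q, hq, hqη⟩ := exists_dotProduct_eq_zero_of_mem_affineCone hη h0
      have hqX := (mem_smoothLocus_iff hn).1 hq
      have hqcone : q.rep ∈ affineCone X := rep_mem_affineCone_iff.2 hqX.1
      obtain ⟨f', hf', hrank'⟩ := exists_jacobian_rank (coneIdeal X) q.rep hqX.2 hcd
      have hTq := tangentAt_eq_ker_jacobian hf' hrank' hqX.2 hcd
      rw [tangentSpace_eq_tangentAt, hTq] at hqη
      obtain ⟨t, ht⟩ := exists_transpose_mulVec_eq (jacobian f' q.rep) η hqη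
      -- The equations `f` may degenerate at the smooth point q, so η is extended to a conormal
      -- field by equations `f'` that are independent at q. Along it g vanishes wherever δ ≠ 0;
      -- since the ideal is prime and omits δ, g also vanishes at η.
      let g' : MvPolynomial (Fin (N + 1)) K :=
        aeval (fun i => ∑ a, pderiv i (f' a) * C (t a)) g
      have hg' : ∀ p : Fin (N + 1) → K, aeval p g' = aeval ((jacobian f' p)ᵀ *ᵥ t) g := by
        intro p
        have : (aeval p).comp (aeval fun i => ∑ a, pderiv i (f' a) * C (t a)) =
            (aeval ((jacobian f' p)ᵀ *ᵥ t) : MvPolynomial (Fin (N + 1)) K →ₐ[K] K) := by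
          ext i
          simp [Matrix.mulVec, dotProduct, jacobian]
        exact DFunLike.congr_fun this g
      have hmul : δ * g' ∈ coneIdeal X := by
        rw [mem_coneIdeal_iff_puncturedCone hX.nonempty]
        intro p hp
        rw [map_mul]
        by_cases hpδ : aeval p δ = 0
        · rw [hpδ, zero_mul]
        · have hT := (hreg p hp hpδ).1
          obtain ⟨t', ht'⟩ := exists_transpose_mulVec_eq (jacobian f p)
            ((jacobian f' p)ᵀ *ᵥ t) (by
              intro w hw
              have hw' : w ∈ tangentAt (coneIdeal X) p := by
                rw [hT]
                exact hw
              have hw0 : jacobian f' p *ᵥ w = 0 := tangentAt_le_ker_jacobian hf' p hw'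
              rw [mulVec_transpose, ← dotProduct_mulVec, hw0, dotProduct_zero])
          rw [hg', ← ht', h p hp t', mul_zero]
      have hg'I := (hX.isPrime.mem_or_mem hmul).resolve_left hδI
      have := mem_coneIdeal.1 hg'I _ hqcone
      rwa [hg', ht] at this
  · intro hg
    -- The factor δ absorbs the points where `f` degenerates; it is cancelled at the generic point.
    have hmul : ∀ p ∈ puncturedCone X, ∀ t : Fin c → K,
        aeval (Sum.elim p t) (rename Sum.inl δ * conormalPoly f g) = 0 := by
      intro p hp t
      rw [map_mul, aeval_elim_rename_inl, aeval_conormalPoly]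
      by_cases hpδ : aeval p δ = 0
      · rw [hpδ, zero_mul]
      · obtain ⟨hT, hTn⟩ := hreg p hp hpδ
        obtain ⟨hsm, hTp⟩ := mk_mem_smoothLocus hn hp hTn
        rw [mem_coneIdeal.1 hg _ (mem_affineCone_tangentHyperplanes hsm _), mul_zero]
        intro v hv
        rw [hTp, hT] at hv
        have hv0 : jacobian f p *ᵥ v = 0 := hv
        rw [mulVec_transpose, ← dotProduct_mulVec, hv0, dotProduct_zero]
    have h1 := (hgen _).2 hmul
    rw [map_mul, mul_eq_zero, aeval_elim_rename_inl] at h1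
    have h2 := h1.resolve_left hδ
    intro p hp t
    rw [← aeval_conormalPoly]
    exact (hgen _).1 h2 p hp t

end Dual

end DualVariety

/-! ### Adapted frames -/

namespace DualVariety

open MvPolynomial Matrix

/-! ### Adapted bases and radicals of bilinear forms. -/

section Frames

variable {K V : Type*} [Field K] [AddCommGroup V] [Module K V]

theorem exists_basis_extending [FiniteDimensional K V] {ι : Type*} [Fintype ι] {u : ι → V}
    (hu : LinearIndependent K u) {k : ℕ} (hk : Module.finrank K V = Fintype.card ι + k) :
    ∃ b : Module.Basis (ι ⊕ Fin k) K V, ∀ i, b (Sum.inl i) = u i := by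
  obtain ⟨C, hC⟩ := Submodule.exists_isCompl (Submodule.span K (Set.range u))
  have hCk : Module.finrank K C = k := by
    have h1 := Submodule.finrank_add_eq_of_isCompl hC
    rw [finrank_span_eq_card hu] at h1
    omega
  let w : Fin k → V := fun j => Module.finBasisOfFinrankEq K C hCk j
  have hw : LinearIndependent K w :=
    (Module.finBasisOfFinrankEq K C hCk).linearIndependent.map' C.subtype C.ker_subtype
  have hdisj : Disjoint (Submodule.span K (Set.range u)) (Submodule.span K (Set.range w)) := by
    refine hC.disjoint.mono_right (Submodule.span_le.2 ?_)
    rintro _ ⟨j, rfl⟩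
    exact (Module.finBasisOfFinrankEq K C hCk j).2
  have hcard : Fintype.card (ι ⊕ Fin k) = Module.finrank K V := by
    rw [Fintype.card_sum, Fintype.card_fin, hk]
  let b := basisOfLinearIndependentOfCardEqFinrank' _ (hu.sum_type hw hdisj) hcard
  exact ⟨b, fun i => by simp [b]⟩

theorem exists_adapted_basis [FiniteDimensional K V] {G : Submodule K V} {l r : ℕ}
    (hG : Module.finrank K G = 1 + l) (hV : Module.finrank K V = 1 + l + r) {e : V} (he : e ∈ G)
    (he0 : e ≠ 0) :
    ∃ b : Module.Basis (Fin 1 ⊕ Fin l ⊕ Fin r) K V, b (Sum.inl 0) = e ∧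
      (∀ a, b (Sum.inr (Sum.inl a)) ∈ G) ∧ ∀ v ∈ G, ∀ p, b.repr v (Sum.inr (Sum.inr p)) = 0 := by
  have h1 : LinearIndependent K (fun _ : Fin 1 => (⟨e, he⟩ : G)) :=
    LinearIndependent.of_subsingleton 0 fun h => he0 (congrArg Subtype.val h)
  obtain ⟨bG, hbG⟩ := exists_basis_extending h1 (k := l) (by rw [hG, Fintype.card_fin])
  obtain ⟨b, hb⟩ := exists_basis_extending
    (bG.linearIndependent.map' G.subtype G.ker_subtype) (k := r) (by
      rw [hV, Fintype.card_sum, Fintype.card_fin, Fintype.card_fin])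
  have hb' : ∀ i, b (Sum.inl i) = bG i := hb
  let σ := Equiv.sumAssoc (Fin 1) (Fin l) (Fin r)
  refine ⟨b.reindex σ, ?_, fun a => ?_, fun v hv p => ?_⟩
  · rw [Module.Basis.reindex_apply]
    change b (Sum.inl (Sum.inl 0)) = e
    rw [hb', hbG]
  · rw [Module.Basis.reindex_apply]
    change b (Sum.inl (Sum.inr a)) ∈ G
    rw [hb']
    exact (bG _).2
  · rw [Module.Basis.repr_reindex_apply]
    change b.repr v (Sum.inr p) = 0
    have hsum : v = ∑ i, bG.repr ⟨v, hv⟩ i • (b (Sum.inl i)) := by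
      have := congrArg Subtype.val (bG.sum_repr ⟨v, hv⟩)
      simp only [hb']
      rw [AddSubmonoidClass.coe_finsetSum] at this
      exact this.symm
    rw [hsum]
    simp

/-- A radical vector is determined by its first 1 + l coordinates: if they vanish, the remaining
ones form a vector killed by an invertible matrix. -/
theorem finrank_radical_le [FiniteDimensional K V] {l r : ℕ}
    (A : Module.Basis (Fin 1 ⊕ Fin l ⊕ Fin r) K V) (Φ : LinearMap.BilinForm K V)
    (hdet : (Matrix.of fun p q => Φ (A (Sum.inr (Sum.inr p))) (A (Sum.inr (Sum.inr q)))).det ≠ 0)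
    {R : Submodule K V} (hR : ∀ v ∈ R, ∀ w, Φ v w = 0) : Module.finrank K R ≤ 1 + l := by
  let τ : R →ₗ[K] (Fin 1 ⊕ Fin l → K) :=
    (LinearMap.funLeft K K (Sum.map id Sum.inl)).comp
      ((A.equivFun : V →ₗ[K] (Fin 1 ⊕ Fin l ⊕ Fin r → K)).comp R.subtype)
  have hτ : Function.Injective τ := by
    rw [injective_iff_map_eq_zero]
    rintro ⟨v, hv⟩ h
    have h1 : ∀ i, A.repr v (Sum.inl i) = 0 := fun i => congrFun h (Sum.inl i)
    have h2 : ∀ a, A.repr v (Sum.inr (Sum.inl a)) = 0 := fun a => congrFun h (Sum.inr a)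
    have hsum : v = ∑ p, A.repr v (Sum.inr (Sum.inr p)) • A (Sum.inr (Sum.inr p)) := by
      conv_lhs => rw [← A.sum_repr v]
      rw [Fintype.sum_sum_type, Fintype.sum_sum_type]
      simp only [h1, h2, zero_smul, Finset.sum_const_zero, zero_add]
    have h3 : (fun p => A.repr v (Sum.inr (Sum.inr p))) = 0 := by
      apply eq_zero_of_vecMul_eq_zero hdet
      ext q
      have := hR v hv (A (Sum.inr (Sum.inr q)))
      rw [hsum] at this
      simpa [Matrix.vecMul, dotProduct] using this
    ext
    rw [Submodule.coe_zero]
    change v = 0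
    rw [hsum]
    exact Finset.sum_eq_zero fun p _ => by rw [congrFun h3 p, Pi.zero_apply, zero_smul]
  simpa using LinearMap.finrank_le_finrank_of_injective hτ

/-- A null vector of the matrix gives a combination of the last r basis vectors that is orthogonal
to the whole basis. It then lies in G, where those coordinates vanish. -/
theorem det_ne_zero_of_radical_le {l r : ℕ} (A : Module.Basis (Fin 1 ⊕ Fin l ⊕ Fin r) K V)
    (Φ : LinearMap.BilinForm K V) {G : Submodule K V} (h0 : A (Sum.inl 0) ∈ G)
    (hA : ∀ a, A (Sum.inr (Sum.inl a)) ∈ G) (hG : ∀ v, ∀ w ∈ G, Φ v w = 0)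
    (hrad : ∀ v, (∀ w, Φ v w = 0) → v ∈ G)
    (hrepr : ∀ v ∈ G, ∀ p, A.repr v (Sum.inr (Sum.inr p)) = 0) :
    (Matrix.of fun p q => Φ (A (Sum.inr (Sum.inr p))) (A (Sum.inr (Sum.inr q)))).det ≠ 0 := by
  intro hdet
  obtain ⟨a, ha, haM⟩ := exists_vecMul_eq_zero_iff.2 hdet
  apply ha
  let v := ∑ p, a p • A (Sum.inr (Sum.inr p))
  have hv : v ∈ G := by
    apply hrad
    have : Φ v = 0 := by
      refine A.ext fun i => ?_
      rcases i with i | i | q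
      · rw [Subsingleton.elim i 0]
        exact hG _ _ h0
      · exact hG _ _ (hA i)
      · have := congrFun haM q
        simpa [v, Matrix.vecMul, dotProduct] using this
    intro w
    rw [this, LinearMap.zero_apply]
  ext p
  have := hrepr v hv p
  simpa [v, Finsupp.single_apply] using this

end Frames

/-! ### Hessians and displacements. -/

section Hessian

variable {K σ ι : Type*} [Field K] [Fintype ι]

theorem hessian_transpose {A : Type*} [Field A] [Algebra K A] (f : ι → MvPolynomial σ K)
    (y : σ → A) (s : ι → A) : (hessian f y s)ᵀ = hessian f y s := by
  ext i j
  simp only [hessian, transpose_apply, of_apply]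
  exact Finset.sum_congr rfl fun a _ => by rw [pderiv_pderiv_comm]

variable [Fintype σ]

theorem hessian_mulVec_dotProduct (f : ι → MvPolynomial σ K) (y : σ → K) (s : ι → K)
    (v w : σ → K) : (hessian f y s *ᵥ v) ⬝ᵥ w = v ⬝ᵥ hessian f y s *ᵥ w := by
  rw [dotProduct_mulVec, ← mulVec_transpose, hessian_transpose]

/-- Sum the displacement equations of the fₐ with weights sₐ. With ξ = Jᵀs this reads ξ(u) = -H(v,
w), which identifies Φ(ξ) with -H on tangent vectors. -/
theorem dotProduct_hessian_add {I : Ideal (MvPolynomial σ K)} {f : ι → MvPolynomial σ K}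
    (hf : ∀ a, f a ∈ I) (y : σ → K) (s : ι → K) {v w u : σ → K}
    (h : ∀ g ∈ I, ∑ i, ∑ j, aeval y (pderiv i (pderiv j g)) * v i * w j
      + ∑ i, aeval y (pderiv i g) * u i = 0) :
    v ⬝ᵥ hessian f y s *ᵥ w + ((jacobian f y)ᵀ *ᵥ s) ⬝ᵥ u = 0 := by
  have h1 : ∑ a, s a * (∑ i, ∑ j, aeval y (pderiv i (pderiv j (f a))) * v i * w j
      + ∑ i, aeval y (pderiv i (f a)) * u i) = 0 :=
    Finset.sum_eq_zero fun a _ => by rw [h _ (hf a), mul_zero]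
  rw [← h1]
  simp only [mul_add, Finset.sum_add_distrib, dotProduct, Matrix.mulVec, hessian, jacobian,
    transpose_apply, of_apply, Finset.mul_sum, Finset.sum_mul]
  congr 1
  · rw [Finset.sum_congr rfl fun i _ => Finset.sum_comm, Finset.sum_comm]
    exact Finset.sum_congr rfl fun a _ => Finset.sum_congr rfl fun i _ =>
      Finset.sum_congr rfl fun j _ => by ring
  · rw [Finset.sum_comm]
    exact Finset.sum_congr rfl fun a _ => Finset.sum_congr rfl fun i _ => by ring

end Hessian

theorem jacobian_scale {K : Type*} [Field K] {N c : ℕ} (f : Fin c → MvPolynomial (Fin (N + 1)) K)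
    (t : K) (y : Fin (N + 1) → K) :
    jacobian (fun a => scale t (f a)) y = t • jacobian f (t • y) := by
  ext a i
  simp only [jacobian, of_apply, Matrix.smul_apply, pderiv_scale, map_mul, aeval_scale, algHom_C,
    Algebra.algebraMap_self, RingHom.id_apply, smul_eq_mul]

/-- A point found on the cone need not be the chosen representative. Replacing s by t⁻¹s makes the
Hessian pick up the same factor t as the Jacobian, so the bordered matrix is only multiplied by a
scalar. -/
theorem hessian_scale {K : Type*} [Field K] {N c : ℕ} (f : Fin c → MvPolynomial (Fin (N + 1)) K)
    {t : K} (ht : t ≠ 0) (y : Fin (N + 1) → K) (s : Fin c → K) :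
    hessian (fun a => scale t (f a)) y (t⁻¹ • s) = t • hessian f (t • y) s := by
  ext i j
  simp only [hessian, of_apply, Matrix.smul_apply, pderiv_scale, pderiv_C_mul, map_mul, aeval_scale,
    Pi.smul_apply, smul_eq_mul, Finset.mul_sum, algHom_C, Algebra.algebraMap_self, RingHom.id_apply]
  exact Finset.sum_congr rfl fun a _ => by field_simp

theorem rank_smul_of_ne_zero {K m n : Type*} [Field K] [Fintype m] [Fintype n] {t : K} (ht : t ≠ 0)
    (M : Matrix m n K) : (t • M).rank = M.rank :=
  rank_smul_of_mem_nonZeroDivisors M (mem_nonZeroDivisors_of_ne_zero ht)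

/-- F is the fraction field of the coordinate ring of I, and L = F(s) adjoins the conormal
parameters. -/
theorem exists_generic_point.{u} {K : Type u} [Field K] {m : ℕ}
    (I : Ideal (MvPolynomial (Fin m) K)) [I.IsPrime] (c : ℕ) :
    ∃ (F L : Type u) (_ : Field F) (_ : Field L) (_ : Algebra K F) (_ : Algebra F L)
      (_ : Algebra K L) (_ : IsScalarTower K F L) (x : Fin m → F) (s : Fin c → L),
      (∀ f, aeval x f = 0 ↔ f ∈ I) ∧ AlgebraicIndependent F s := by
  let F := FractionRing (MvPolynomial (Fin m) K ⧸ I)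
  let L := FractionRing (MvPolynomial (Fin c) F)
  let x : Fin m → F := fun i =>
    algebraMap (MvPolynomial (Fin m) K ⧸ I) F (Ideal.Quotient.mk I (X i))
  let s : Fin c → L := fun a => algebraMap (MvPolynomial (Fin c) F) L (X a)
  refine ⟨F, L, inferInstance, inferInstance, inferInstance, inferInstance, inferInstance,
    inferInstance, x, s, fun f => ?_, ?_⟩
  · have h : (aeval x : MvPolynomial (Fin m) K →ₐ[K] F) =
        (IsScalarTower.toAlgHom K (MvPolynomial (Fin m) K ⧸ I) F).comp
          (Ideal.Quotient.mkₐ K I) := by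
      ext i
      simp [x]
    rw [h]
    change algebraMap (MvPolynomial (Fin m) K ⧸ I) F (Ideal.Quotient.mk I f) = 0 ↔ _
    rw [IsFractionRing.to_map_eq_zero_iff, Ideal.Quotient.eq_zero_iff_mem]
  · have := (algebraicIndependent_X (Fin c) F).map' (f := IsScalarTower.toAlgHom F
      (MvPolynomial (Fin c) F) L) (IsFractionRing.injective (MvPolynomial (Fin c) F) L)
    exact this

end DualVariety

/-! ### The dimension of the dual variety -/

namespace DualVariety

open MvPolynomial Matrix

section

variable {K : Type*} [Field K] [CharZero K] {N : ℕ} {F L : Type*} [Field F] [Field L]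
  [Algebra K F] [Algebra F L] [Algebra K L] [IsScalarTower K F L]

theorem finrank_tangentAt_generic {X : Set (Pr K N)} {n : ℕ} (hn : projDim X = n)
    {y : Fin (N + 1) → L} (hy : ∀ f, aeval y f = 0 ↔ f ∈ coneIdeal X) :
    Module.finrank L (tangentAt (coneIdeal X) y) = n + 1 := by
  have : CharZero L := charZero_of_injective_algebraMap (algebraMap K L).injective
  have h := toNat_trdeg_quotient hy
  unfold projDim at hn
  omega

theorem projDim_dualVariety_add {X : Set (Pr K N)} (hX : IsVariety X) {n c : ℕ}
    (hn : projDim X = n) (hcn : c + (n + 1) = N + 1) {x : Fin (N + 1) → F}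
    (hx : ∀ f, aeval x f = 0 ↔ f ∈ coneIdeal X) {s : Fin c → L} (hs : AlgebraicIndependent F s)
    {f : Fin c → MvPolynomial (Fin (N + 1)) K} (hf : ∀ a, f a ∈ coneIdeal X)
    (hrank : (jacobian f (algebraMap F L ∘ x)).rank = c) :
    projDim (dualVariety X) + 1 + c = (bordered (hessian f (algebraMap F L ∘ x) s)
      (jacobian f (algebraMap F L ∘ x))).rank := by
  have hd := finrank_tangentAt_generic (L := L) (y := algebraMap F L ∘ x) hn fun f =>
    (aeval_comp_algebraMap_eq_zero x f).trans (hx f)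
  have hcd : c + (n + 1) = Fintype.card (Fin (N + 1)) := by rw [Fintype.card_fin, hcn]
  have h1 := toNat_trdeg_conormal hx hs hd hcd hf hrank
    (aeval_conormal_eq_zero_iff hX hn hcn hx hs hd hf hrank)
  have h2 := finrank_borderedImage_add (hessian f (algebraMap F L ∘ x) s)
    (jacobian f (algebraMap F L ∘ x)) (by rw [hrank, Fintype.card_fin])
  rw [Fintype.card_fin] at h2
  unfold projDim
  rw [dualVariety, coneIdeal_zariskiClosure]
  omega

end

/-! ### The second fundamental form at K-points. -/

section Points

variable {K : Type*} [Field K] {N : ℕ}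

theorem secondFundamentalForm_apply {X : Set (Pr K N)} {q : Pr K N} {c : ℕ}
    {f : Fin c → MvPolynomial (Fin (N + 1)) K} (hf : ∀ a, f a ∈ coneIdeal X) {s : Fin c → K}
    {Φ : LinearMap.BilinForm K (tangentSpace X q)} {v w : tangentSpace X q}
    {u : Fin (N + 1) → K} (hu : Displacement X q v w u)
    (hΦ : Φ v w = ((jacobian f q.rep)ᵀ *ᵥ s) ⬝ᵥ u) :
    Φ v w = -((v : Fin (N + 1) → K) ⬝ᵥ hessian f q.rep s *ᵥ w) := by
  rw [hΦ]
  exact eq_neg_of_add_eq_zero_right (dotProduct_hessian_add hf q.rep s hu)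

/-- The member of the second fundamental form given by the covector `Jᵀ s`. -/
noncomputable def hessianForm (X : Set (Pr K N)) (q : Pr K N) {c : ℕ}
    (f : Fin c → MvPolynomial (Fin (N + 1)) K) (s : Fin c → K) :
    LinearMap.BilinForm K (tangentSpace X q) :=
  -(Matrix.toLinearMap₂' K (hessian f q.rep s)).domRestrict₁₂ (tangentSpace X q) (tangentSpace X q)

theorem hessianForm_apply (X : Set (Pr K N)) (q : Pr K N) {c : ℕ}
    (f : Fin c → MvPolynomial (Fin (N + 1)) K) (s : Fin c → K) (v w : tangentSpace X q) :
    hessianForm X q f s v w = -((v : Fin (N + 1) → K) ⬝ᵥ hessian f q.rep s *ᵥ w) := by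
  rw [hessianForm, LinearMap.neg_apply, LinearMap.neg_apply, LinearMap.domRestrict₁₂_apply,
    Matrix.toLinearMap₂'_apply']

theorem hessianForm_mem_secondFundamentalForm {X : Set (Pr K N)} {q : Pr K N} {c : ℕ}
    {f : Fin c → MvPolynomial (Fin (N + 1)) K} (hf : ∀ a, f a ∈ coneIdeal X) (s : Fin c → K) :
    hessianForm X q f s ∈ secondFundamentalForm X q := by
  refine ⟨(jacobian f q.rep)ᵀ *ᵥ s, fun v hv => ?_, fun v w u hu => ?_⟩
  · have hv0 : jacobian f q.rep *ᵥ v = 0 := tangentAt_le_ker_jacobian hf q.rep hv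
    change ((jacobian f q.rep)ᵀ *ᵥ s) ⬝ᵥ v = 0
    rw [mulVec_transpose, ← dotProduct_mulVec, hv0, dotProduct_zero]
  · rw [hessianForm_apply]
    exact neg_eq_of_add_eq_zero_right (dotProduct_hessian_add hf q.rep s hu)

theorem gaussRankAt_le_gaussRank {X : Set (Pr K N)} {q : Pr K N} (hq : q ∈ smoothLocus X) :
    gaussRankAt X q ≤ gaussRank X := by
  -- The bound keeps the supremum in ℕ from being the default value 0.
  refine le_csSup ⟨N + 1, ?_⟩ ⟨q, hq, rfl⟩
  rintro _ ⟨p, -, rfl⟩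
  have := Submodule.finrank_le (tangentSpace X p)
  rw [Module.finrank_fintype_fun_eq_card, Fintype.card_fin] at this
  exact (Nat.sub_le _ _).trans this

theorem gaussKernel_le_restrictedRadical {X : Set (Pr K N)} {q : Pr K N} {c : ℕ}
    {f : Fin c → MvPolynomial (Fin (N + 1)) K} (hf : ∀ a, f a ∈ coneIdeal X) (s : Fin c → K)
    (hT : tangentSpace X q = LinearMap.ker (jacobian f q.rep).mulVecLin) :
    gaussKernel X q ≤ restrictedRadical (hessian f q.rep s) (jacobian f q.rep) := by
  rintro v ⟨hv, hw⟩
  refine ⟨tangentAt_le_ker_jacobian hf q.rep hv, fun w hw0 => ?_⟩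
  have hwT : w ∈ tangentSpace X q := by
    rw [hT]
    exact hw0
  have := dotProduct_hessian_add hf q.rep s (hw w hwT)
  rwa [dotProduct_zero, add_zero, ← hessian_mulVec_dotProduct] at this

/-- The rank bound makes the radical at most (1 + l)-dimensional, the Gauss rank makes the Gauss
kernel at least (1 + l)-dimensional, and the radical contains the kernel; hence they agree, and the
form is nondegenerate modulo the kernel. -/
theorem exists_adaptedFrame_det_ne_zero [Infinite K] {X : Set (Pr K N)} {n c l r : ℕ}
    (hn : projDim X = n) (hcn : c + (n + 1) = N + 1) (hr : gaussRank X = r) (hl : l + r = n)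
    {q : Pr K N} (hq : q ∈ smoothLocus X) {f : Fin c → MvPolynomial (Fin (N + 1)) K}
    (hf : ∀ a, f a ∈ coneIdeal X) (hrank : (jacobian f q.rep).rank = c) (s : Fin c → K)
    (hB : 2 * c + r ≤ (bordered (hessian f q.rep s) (jacobian f q.rep)).rank) :
    ∃ A : Module.Basis (Fin 1 ⊕ Fin l ⊕ Fin r) K (tangentSpace X q), IsAdaptedFrame X q A ∧
      ∃ Φ ∈ secondFundamentalForm X q, (gaussMatrix A Φ).det ≠ 0 := by
  have hqX := (mem_smoothLocus_iff hn).1 hq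
  have hcd : c + (n + 1) = Fintype.card (Fin (N + 1)) := by rw [Fintype.card_fin, hcn]
  have hT : tangentSpace X q = LinearMap.ker (jacobian f q.rep).mulVecLin :=
    tangentAt_eq_ker_jacobian hf hrank hqX.2 hcd
  have hTn : Module.finrank K (tangentSpace X q) = n + 1 := hqX.2
  have hle := gaussKernel_le_restrictedRadical hf s hT
  have hrad := finrank_restrictedRadical_add (hessian f q.rep s) (jacobian f q.rep)
    (by rw [hrank, Fintype.card_fin])
  rw [Fintype.card_fin, Fintype.card_fin] at hrad
  have hgr := gaussRankAt_le_gaussRank hq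
  rw [hr, gaussRankAt, hTn] at hgr
  have hmono := Submodule.finrank_mono hle
  have hker : gaussKernel X q = restrictedRadical (hessian f q.rep s) (jacobian f q.rep) :=
    Submodule.eq_of_le_of_finrank_le hle (by omega)
  have hkT : gaussKernel X q ≤ tangentSpace X q := fun v hv => hv.1
  let G : Submodule K (tangentSpace X q) := (gaussKernel X q).comap (tangentSpace X q).subtype
  have hGn : Module.finrank K G = 1 + l := by
    rw [(Submodule.comapSubtypeEquivOfLe hkT).finrank_eq]
    omega
  have hrep := rep_mem_gaussKernel hqX.1
  obtain ⟨A, hA0, hAa, hrepr⟩ := exists_adapted_basis (r := r) hGn (by omega)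
    (e := ⟨q.rep, hkT hrep⟩) hrep (fun h => q.rep_nonzero (congrArg Subtype.val h))
  refine ⟨A, ⟨by rw [hA0], hAa⟩, hessianForm X q f s, hessianForm_mem_secondFundamentalForm hf s,
    ?_⟩
  refine det_ne_zero_of_radical_le A _ (G := G) (by rw [hA0]; exact hrep) hAa ?_ ?_ hrepr
  · intro v w hw
    have hw' : (w : Fin (N + 1) → K) ∈ gaussKernel X q := hw
    rw [hker] at hw'
    have hv0 : jacobian f q.rep *ᵥ v = 0 := tangentAt_le_ker_jacobian hf q.rep v.2
    rw [hessianForm_apply, dotProduct_comm, hw'.2 v hv0, neg_zero]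
  · intro v hv
    change (v : Fin (N + 1) → K) ∈ gaussKernel X q
    rw [hker]
    refine ⟨tangentAt_le_ker_jacobian hf q.rep v.2, fun w hw => ?_⟩
    have hwT : w ∈ tangentSpace X q := by
      rw [hT]
      exact hw
    have := hv ⟨w, hwT⟩
    rwa [hessianForm_apply, neg_eq_zero, ← hessian_mulVec_dotProduct] at this

end Points

/-! ### The two inequalities between the dimension of the dual variety and the rank of the forms. -/

section Main

variable {K : Type*} [Field K] [CharZero K] {N : ℕ} {F L : Type*} [Field F] [Field L]
  [Algebra K F] [Algebra F L] [Algebra K L] [IsScalarTower K F L]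

theorem le_projDim_dualVariety {X : Set (Pr K N)} (hX : IsVariety X) {n c l r : ℕ}
    (hn : projDim X = n) (hcn : c + (n + 1) = N + 1) {x : Fin (N + 1) → F}
    (hx : ∀ f, aeval x f = 0 ↔ f ∈ coneIdeal X) {s : Fin c → L} (hs : AlgebraicIndependent F s)
    {q : Pr K N} (hq : q ∈ smoothLocus X)
    (A : Module.Basis (Fin 1 ⊕ Fin l ⊕ Fin r) K (tangentSpace X q))
    {Φ : LinearMap.BilinForm K (tangentSpace X q)} (hΦ : Φ ∈ secondFundamentalForm X q)
    (hdet : (gaussMatrix A Φ).det ≠ 0) :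
    (N : ℤ) - l - 1 ≤ projDim (dualVariety X) := by
  have hqX := (mem_smoothLocus_iff hn).1 hq
  have hcd : c + (n + 1) = Fintype.card (Fin (N + 1)) := by rw [Fintype.card_fin, hcn]
  obtain ⟨f, hf, hrank⟩ := exists_jacobian_rank (coneIdeal X) q.rep hqX.2 hcd
  have hT : tangentSpace X q = LinearMap.ker (jacobian f q.rep).mulVecLin :=
    tangentAt_eq_ker_jacobian hf hrank hqX.2 hcd
  have hy : ∀ f, aeval (algebraMap F L ∘ x) f = 0 ↔ f ∈ coneIdeal X := fun f =>
    (aeval_comp_algebraMap_eq_zero x f).trans (hx f)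
  have hd := finrank_tangentAt_generic hn hy
  have hqI : ∀ f ∈ coneIdeal X, aeval q.rep f = 0 := fun f hf =>
    mem_coneIdeal.1 hf _ (rep_mem_affineCone_iff.2 hqX.1)
  have hrankL : (jacobian f (algebraMap F L ∘ x)).rank = c := by
    refine le_antisymm ?_ (hrank.symm.le.trans (rank_jacobian_le_of_generic hy hqI f))
    simpa using Matrix.rank_le_card_height (jacobian f (algebraMap F L ∘ x))
  have hdim := projDim_dualVariety_add hX hn hcn hx hs hf hrankL
  obtain ⟨ξ, hξ, hΦξ⟩ := hΦ
  rw [hT] at hξ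
  obtain ⟨t, rfl⟩ := exists_transpose_mulVec_eq (jacobian f q.rep) ξ hξ
  have hΦt : ∀ v w : tangentSpace X q,
      Φ v w = -((v : Fin (N + 1) → K) ⬝ᵥ hessian f q.rep t *ᵥ w) := by
    intro v w
    -- Membership in the second fundamental form constrains Φ(v, w) only through displacements; one
    -- exists at a smooth point, so Φ(v, w) is determined.
    obtain ⟨u, hu⟩ := exists_displacement hy hqI hd hcd hf hrank v.2 w.2
    exact secondFundamentalForm_apply hf hu (hΦξ v w u hu)
  have hrad := finrank_restrictedRadical_add (hessian f q.rep t) (jacobian f q.rep)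
    (by rw [hrank, Fintype.card_fin])
  rw [Fintype.card_fin, Fintype.card_fin] at hrad
  have hradT : restrictedRadical (hessian f q.rep t) (jacobian f q.rep) ≤ tangentSpace X q := by
    rw [hT]
    exact fun v hv => hv.1
  have hle := finrank_radical_le A Φ hdet
    (R := (restrictedRadical (hessian f q.rep t) (jacobian f q.rep)).comap
      (tangentSpace X q).subtype) (by
      intro v hv w
      have hw0 : jacobian f q.rep *ᵥ w = 0 := tangentAt_le_ker_jacobian hf q.rep w.2
      rw [hΦt, ← hessian_mulVec_dotProduct]
      exact neg_eq_zero.2 (hv.2 w hw0))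
  rw [(Submodule.comapSubtypeEquivOfLe hradT).finrank_eq] at hle
  have hspec : (bordered (hessian f q.rep t) (jacobian f q.rep)).rank ≤
      (bordered (hessian f (algebraMap F L ∘ x) s) (jacobian f (algebraMap F L ∘ x))).rank := by
    rw [← borderedPoly_map, ← borderedPoly_map]
    refine rank_map_le_of_ker_le _ _ _ fun G hG => ?_
    exact (aeval_elim_eq_zero_iff (V := puncturedCone X)
      (fun f => (hx f).trans (mem_coneIdeal_iff_puncturedCone hX.nonempty)) hs G).1 hG q.rep
      ⟨rep_mem_affineCone_iff.2 hqX.1, q.rep_nonzero⟩ t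
  omega

theorem exists_rank_bordered_of_le_projDim {X : Set (Pr K N)} (hX : IsVariety X) {n c l r : ℕ}
    (hn : projDim X = n) (hcn : c + (n + 1) = N + 1) (hl : l + r = n) {x : Fin (N + 1) → F}
    (hx : ∀ f, aeval x f = 0 ↔ f ∈ coneIdeal X) {s : Fin c → L} (hs : AlgebraicIndependent F s)
    (hdim : (N : ℤ) - l - 1 ≤ projDim (dualVariety X)) :
    ∃ q ∈ smoothLocus X, ∃ f : Fin c → MvPolynomial (Fin (N + 1)) K, (∀ a, f a ∈ coneIdeal X) ∧
      (jacobian f q.rep).rank = c ∧ ∃ t : Fin c → K,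
        2 * c + r ≤ (bordered (hessian f q.rep t) (jacobian f q.rep)).rank := by
  have hcd : c + (n + 1) = Fintype.card (Fin (N + 1)) := by rw [Fintype.card_fin, hcn]
  have hy : ∀ f, aeval (algebraMap F L ∘ x) f = 0 ↔ f ∈ coneIdeal X := fun f =>
    (aeval_comp_algebraMap_eq_zero x f).trans (hx f)
  have hd := finrank_tangentAt_generic hn hy
  obtain ⟨f, hf, hrank⟩ := exists_jacobian_rank (coneIdeal X) (algebraMap F L ∘ x) hd hcd
  have hadd := projDim_dualVariety_add hX hn hcn hx hs hf hrank
  have hB : 2 * c + r ≤ (bordered (hessian f (algebraMap F L ∘ x) s)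
      (jacobian f (algebraMap F L ∘ x))).rank := by omega
  rw [← borderedPoly_map] at hB
  obtain ⟨δ, hδ, hδK⟩ := exists_le_rank_map_of_ne_zero (B := K) _ _ hB
  have hJ : c ≤ ((jacobianPoly f).map (aeval (algebraMap F L ∘ x) : _ →ₐ[K] L).toRingHom).rank :=
    hrank.symm.le
  obtain ⟨ε, hε, hεK⟩ := exists_le_rank_map_of_ne_zero (B := K) _ _ hJ
  -- A K-point where this product of minors is nonzero is smooth (ε) and keeps the rank of the
  -- bordered matrix (δ).
  have hne : aeval (Sum.elim (algebraMap F L ∘ x) s) (rename Sum.inl ε * δ) ≠ 0 := by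
    rw [map_mul, aeval_elim_rename_inl]
    exact mul_ne_zero hε hδ
  rw [Ne, aeval_elim_eq_zero_iff (V := puncturedCone X)
    (fun f => (hx f).trans (mem_coneIdeal_iff_puncturedCone hX.nonempty)) hs] at hne
  push Not at hne
  obtain ⟨p, hp, t, hpt⟩ := hne
  rw [map_mul, aeval_elim_rename_inl] at hpt
  have hJp : (jacobian f p).rank = c :=
    le_antisymm (by simpa using Matrix.rank_le_card_height (jacobian f p))
      (hεK (aeval p : _ →ₐ[K] K).toRingHom (left_ne_zero_of_mul hpt))
  have hBp := hδK (aeval (Sum.elim p t) : _ →ₐ[K] K).toRingHom (right_ne_zero_of_mul hpt)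
  rw [borderedPoly_map] at hBp
  have hTp : Module.finrank K (tangentAt (coneIdeal X) p) = n + 1 := by
    rw [tangentAt_eq_ker_jacobian_of_rank hy (fun f hf => mem_coneIdeal.1 hf p hp.1) hd hcd hf hJp]
    have := finrank_ker_mulVecLin (jacobian f p)
    omega
  obtain ⟨τ, hτ, hpτ⟩ := exists_smul_rep_eq hp.2
  have hJτ : jacobian (fun a => scale τ (f a)) (Projectivization.mk K p hp.2).rep =
      τ • jacobian f p := by
    rw [jacobian_scale, ← hpτ]
  have hHτ : hessian (fun a => scale τ (f a)) (Projectivization.mk K p hp.2).rep (τ⁻¹ • t) =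
      τ • hessian f p t := by
    rw [hessian_scale f hτ, ← hpτ]
  refine ⟨_, (mk_mem_smoothLocus hn hp hTp).1, fun a => scale τ (f a),
    fun a => scale_mem_coneIdeal (hf a) τ, ?_, τ⁻¹ • t, ?_⟩
  · rw [hJτ, rank_smul_of_ne_zero hτ, hJp]
  · have hBτ : bordered (τ • hessian f p t) (τ • jacobian f p) =
        τ • bordered (hessian f p t) (jacobian f p) := by
      simp [bordered, fromBlocks_smul]
    rw [hJτ, hHτ, hBτ, rank_smul_of_ne_zero hτ]
    exact hBp

end Main

end DualVariety

theorem theorem4 {K : Type*} [Field K] [CharZero K] {N : ℕ} (X : Set (DualVariety.Pr K N))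
    (hX : DualVariety.IsVariety X) (n r l : ℕ) (hn : DualVariety.projDim X = (n : ℤ))
    (hr : DualVariety.gaussRank X = r) (hl : l + r = n) :
    DualVariety.projDim (DualVariety.dualVariety X) < (N : ℤ) - (l : ℤ) - 1 ↔
      ∀ x ∈ DualVariety.smoothLocus X,
        ∀ A : Module.Basis (Fin 1 ⊕ Fin l ⊕ Fin r) K (DualVariety.tangentSpace X x),
          DualVariety.IsAdaptedFrame X x A →
            ∀ Φ ∈ DualVariety.secondFundamentalForm X x,
              (DualVariety.gaussMatrix A Φ).det = 0 := by
  have := hX.isPrime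
  obtain ⟨F, L, _, _, _, _, _, _, x, s, hx, hs⟩ :=
    DualVariety.exists_generic_point (DualVariety.coneIdeal X) (N - n)
  -- `N - n` is a truncated subtraction; this bound makes it the true codimension.
  have hnN : n ≤ N := by
    have h1 := DualVariety.finrank_tangentAt_generic hn hx
    have h2 := Submodule.finrank_le (DualVariety.tangentAt (DualVariety.coneIdeal X) x)
    rw [Module.finrank_fintype_fun_eq_card, Fintype.card_fin, h1] at h2
    omega
  have hcn : N - n + (n + 1) = N + 1 := by omega
  constructor
  · intro hlt q hq A _ Φ hΦ
    by_contra hdet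
    exact hlt.not_ge (DualVariety.le_projDim_dualVariety hX hn hcn hx hs hq A hΦ hdet)
  · intro hdet
    by_contra hlt
    obtain ⟨q, hq, f, hf, hrank, t, hB⟩ :=
      DualVariety.exists_rank_bordered_of_le_projDim hX hn hcn hl hx hs (not_lt.1 hlt)
    obtain ⟨A, hA, Φ, hΦ, hne⟩ :=
      DualVariety.exists_adaptedFrame_det_ne_zero hn hcn hr hl hq hf hrank t hB
    exact hne (hdet q hq A hA Φ hΦ)
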